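/- Let $\Lambda$ be an artin algebra, i.e. an algebra over a commutative artinian ring $R$ that is finitely generated as an $R$-module. All modules are finitely generated left modules unless stated otherwise, and $\mathrm{mod}\,\Lambda$ denotes the category of these modules. Let $K_0$ be the abelian group generated by symbols $[M]$, $M\in\mathrm{mod}\,\Lambda$, with relations $[C]=[A]+[B]$ if $C\simeq A\oplus B$, and $[I]=0$ if $I$ is injective. Let $\Omega^{-1}:K_0\to K_0$ be the homomorphism induced by the cosyzygy, $\Omega^{-1}[M]=[I_0(M)/M]$ with $I_0(M)$ the injective envelope of $M$, and write $\Omega^{-s}$ for its $s$-fold iterate. For $M\in\mathrm{mod}\,\Lambda$ let $\langle\mathrm{add}\,M\rangle\subseteq K_0$ be the subgroup generated by the classes of the direct summands of $M$, and let $\phi_r(M)$ be the smallest integer $n\ge 0$ such that $\Omega^{-1}:\Omega^{-s}\langle\mathrm{add}\,M\rangle\to\Omega^{-(s+1)}\langle\mathrm{add}\,M\rangle$ is an isomorphism for all $s\ge n$. Put $\phi_r\dim(\Lambda)=\sup\{\phi_r(M) : M\in\mathrm{mod}\,\Lambda\}\in\mathbb N\cup\{\infty\}$. Let $\mathfrak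 A$ be a strong idempotent ideal of $\Lambda$, i.e. a two-sided ideal with $\mathfrak A^2=\mathfrak A$ such that the canonical map $\mathrm{Ext}^i_{\Lambda/\mathfrak A}(X,Y)\to\mathrm{Ext}^i_\Lambda(X,Y)$ is an isomorphism for all $i\ge 0$ and all $X,Y\in\mathrm{mod}\,\Lambda/\mathfrak A$. Let $P$ be a finitely generated projective $\Lambda$-module such that $\mathfrak A$ is the trace of $P$ in $\Lambda$ (the sum of the images of all homomorphisms $P\to\Lambda$), and let $\Gamma=\mathrm{End}_\Lambda(P)^{op}$. Then, in $\mathbb N\cup\{\infty\}$, $$\phi_r\dim(\Lambda)\ \le\ \mathrm{pd}\,{}_\Lambda(\Lambda/\mathfrak A)+\max\{\ \mathrm{gld}(\Lambda/\mathfrak A)+\mathrm{pd}\,(\Lambda/\mathfrak A)_\Lambda+1,\ \phi_r\dim(\Gamma)\ \}.$$ Here $\mathrm{pd}\,{}_\Lambda(\Lambda/\mathfrak A)$ and $\mathrm{pd}\,(\Lambda/\mathfrak A)_\Lambda$ are the projective dimensions of $\Lambda/\mathfrak A$ as a left and as a right $\Lambda$-module, $\mathrm{gld}(\Lambda/\mathfrak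 A)$ is the supremum of the projective dimensions of the finitely generated left $\Lambda/\mathfrak A$-modules, and the zero module has projective dimension $0$. -/

import Mathlib

universe u v

theorem injective_of_retract {Λ : Type u} [Ring Λ] {A B : Type u} [AddCommGroup A] [Module Λ A]
    [AddCommGroup B] [Module Λ B] [Module.Injective Λ B] (i : A →ₗ[Λ] B) (r : B →ₗ[Λ] A)
    (h : ∀ a, r (i a) = a) : Module.Injective Λ A where
  out X Y _ _ _ _ f hf g := by
    obtain ⟨k, hk⟩ := Module.Injective.out (Q := B) f hf (i ∘ₗ g)
    exact ⟨r ∘ₗ k, fun x => by simp [hk, h]⟩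

/-- Every submodule of an injective module has an injective envelope inside that module. -/
theorem exists_essential_injective {Λ : Type u} [Ring Λ] {E : Type u} [AddCommGroup E]
    [Module Λ E] [Module.Injective Λ E] (M : Submodule Λ E) :
    ∃ U : Submodule Λ E, M ≤ U ∧ Module.Injective Λ U ∧
      ∀ N : Submodule Λ E, N ≤ U → N ⊓ M = ⊥ → N = ⊥ := by
  let S : Set (Submodule Λ E) := {U | M ≤ U ∧ ∀ N ≤ U, N ⊓ M = ⊥ → N = ⊥}
  have key : ∀ U : Submodule Λ E, (∀ N ≤ U, N ⊓ M = ⊥ → N = ⊥) ↔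
      ∀ x ∈ U, Submodule.span Λ {x} ⊓ M = ⊥ → x = 0 := by
    intro U
    constructor
    · intro h x hx h'
      have := h _ ((Submodule.span_singleton_le_iff_mem x U).2 hx) h'
      simpa using this
    · intro h N hN h'
      rw [Submodule.eq_bot_iff]
      intro x hx
      refine h x (hN hx) (le_bot_iff.1 ?_)
      rw [← h']
      exact inf_le_inf_right _ ((Submodule.span_singleton_le_iff_mem x N).2 hx)
  have hMS : M ∈ S := ⟨le_rfl, fun N hN h => by rwa [inf_eq_left.2 hN] at h⟩
  obtain ⟨U, hMU, hU⟩ := zorn_le_nonempty₀ S (fun c hc hchain y hy => by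
    refine ⟨sSup c, ⟨(hc hy).1.trans (le_sSup hy), ?_⟩, fun z hz => le_sSup hz⟩
    rw [key]
    intro x hx
    obtain ⟨z, hz, hxz⟩ := (Submodule.mem_sSup_of_directed ⟨y, hy⟩ hchain.directedOn).1 hx
    exact (key z).1 (hc hz).2 x hxz) M hMS
  refine ⟨U, hMU, ?_, hU.prop.2⟩
  obtain ⟨V, -, hV⟩ := zorn_le_nonempty₀ {V : Submodule Λ E | V ⊓ U = ⊥}
    (fun c hc hchain y hy => by
      refine ⟨sSup c, ?_, fun z hz => le_sSup hz⟩
      rw [Set.mem_ofPred_eq, Submodule.eq_bot_iff]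
      rintro x ⟨hx, hxU⟩
      obtain ⟨z, hz, hxz⟩ := (Submodule.mem_sSup_of_directed ⟨y, hy⟩ hchain.directedOn).1 hx
      exact (Submodule.eq_bot_iff _).1 (hc hz) x ⟨hxz, hxU⟩) ⊥ (by simp)
  have hVU : V ⊓ U = ⊥ := hV.prop
  have hinj : Function.Injective (V.mkQ ∘ₗ U.subtype) := by
    rw [← LinearMap.ker_eq_bot, Submodule.eq_bot_iff]
    intro x hx
    have h1 : (x : E) ∈ V := by simpa using hx
    exact Subtype.ext ((Submodule.eq_bot_iff _).1 hVU x ⟨h1, x.2⟩)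
  obtain ⟨h, hh⟩ := Module.Injective.out (Q := E) _ hinj U.subtype
  let p : E →ₗ[Λ] E := h ∘ₗ V.mkQ
  have hp : ∀ x ∈ U, p x = x := fun x hx => hh ⟨x, hx⟩
  have hpV : ∀ x ∈ V, p x = 0 := fun x hx => by
    have : V.mkQ x = 0 := by simpa using hx
    simp [p, this]
  -- any submodule meeting `U` trivially modulo `V` lies in `V`
  have hker : ∀ N : Submodule Λ E, V ≤ N → N ⊓ U = ⊥ → N ≤ V := fun N hVN hN => hV.le_of_ge hN hVN
  have hUr : U ≤ LinearMap.range p := fun x hx => ⟨x, hp x hx⟩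
  have hr : LinearMap.range p ≤ U := by
    refine hU.le_of_ge ⟨hMU.trans hUr, fun N hN hNM => ?_⟩ hUr
    have hNU : N ⊓ U = ⊥ := hU.prop.2 _ inf_le_right (by
      rw [inf_assoc, inf_eq_right.2 hMU, hNM])
    have hle : N.comap p ≤ V := by
      refine hker _ (fun x hx => ?_) ?_
      · simp [hpV x hx]
      · rw [Submodule.eq_bot_iff]
        rintro x ⟨hx, hxU⟩
        have hx' : p x ∈ N := hx
        rw [hp x hxU] at hx'
        exact (Submodule.eq_bot_iff _).1 hNU x ⟨hx', hxU⟩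
    rw [Submodule.eq_bot_iff]
    intro y hy
    obtain ⟨x, rfl⟩ := hN hy
    exact hpV x (hle hy)
  refine injective_of_retract U.subtype
    (p.codRestrict U fun x => hr ⟨x, rfl⟩) fun a => Subtype.ext (hp a a.2)

/-- Over an artin algebra, an essential extension of a finitely generated module is finitely
generated. -/
theorem finite_of_essential (R : Type v) {Λ : Type u} [CommRing R] [IsArtinianRing R] [Ring Λ]
    [Algebra R Λ] [Module.Finite R Λ] {E : Type u} [AddCommGroup E] [Module Λ E]
    (M : Submodule Λ E) [Module.Finite Λ M]
    (hM : ∀ N : Submodule Λ E, N ⊓ M = ⊥ → N = ⊥) : Module.Finite Λ E := by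
  let _ : Module R E := Module.compHom E (algebraMap R Λ)
  have : IsScalarTower R Λ E := ⟨fun r l x => by
    rw [Algebra.smul_def, mul_smul]; rfl⟩
  have : IsArtinianRing Λ := IsArtinianRing.of_finite R Λ
  have : Module.Finite R M := Module.Finite.trans Λ M
  let J := Ring.jacobson Λ
  -- `K W` consists of the elements `x` with `J x ⊆ W`
  let K : Submodule Λ E → Submodule Λ E := fun W =>
    { carrier := {x | ∀ a ∈ J, a • x ∈ W}
      add_mem' := fun {x y} hx hy a ha => by rw [smul_add]; exact W.add_mem (hx a ha) (hy a ha)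
      zero_mem' := fun a _ => by rw [smul_zero]; exact W.zero_mem
      smul_mem' := fun c x hx a ha => by
        rw [← mul_smul]; exact hx _ (J.mul_mem_right c ha) }
  have hK1 : K ⊥ ≤ M := by
    have : IsSemisimpleModule Λ (K ⊥) := by
      have ht : Module.IsTorsionBySet Λ (K ⊥) (J : Set Λ) := fun x a =>
        Subtype.ext (x.2 a a.2)
      let _ := ht.module
      exact (ht.isSemisimpleModule_iff).1 inferInstance
    obtain ⟨C, hC⟩ := exists_isCompl (M.comap (K ⊥).subtype)
    have hCb : C.map (K ⊥).subtype = ⊥ := by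
      apply hM
      rw [Submodule.eq_bot_iff]
      rintro x ⟨⟨y, hy, rfl⟩, hxM⟩
      have : y ∈ M.comap (K ⊥).subtype ⊓ C := ⟨hxM, hy⟩
      rw [hC.inf_eq_bot] at this
      simpa using this
    have hC' : C = ⊥ := by
      rw [Submodule.eq_bot_iff]
      intro x hx
      have : (x : E) ∈ C.map (K ⊥).subtype := ⟨x, hx, rfl⟩
      rw [hCb] at this
      exact Subtype.ext this
    have htop := hC.sup_eq_top
    rw [hC', sup_bot_eq] at htop
    intro x hx
    have : (⟨x, hx⟩ : K ⊥) ∈ M.comap (K ⊥).subtype := htop ▸ Submodule.mem_top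
    exact this
  obtain ⟨s, hs⟩ := (IsNoetherian.noetherian (J.restrictScalars R) : (J.restrictScalars R).FG)
  have hstep : ∀ W : Submodule Λ E, Module.Finite R W → Module.Finite R (K W) := by
    intro W hW
    let g : (K W) →ₗ[R] (s → W) :=
      { toFun := fun x j => ⟨(j : Λ) • (x : E), x.2 _ (by
          have hj : (j : Λ) ∈ J.restrictScalars R := hs ▸ Submodule.subset_span j.2
          exact hj)⟩
        map_add' := fun x y => by ext j; simp
        map_smul' := fun r x => by
          ext j
          simp only [RingHom.id_apply, Pi.smul_apply, Submodule.coe_smul_of_tower]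
          exact (smul_comm r (j : Λ) (x : E)).symm }
    have hk : ∀ x : LinearMap.ker g, ((x : K W) : E) ∈ M := by
      intro x
      refine hK1 fun a ha => ?_
      have ha' : a ∈ Submodule.span R (s : Set Λ) := hs ▸ ha
      clear ha
      induction ha' using Submodule.span_induction with
      | mem y hy => exact congrArg Subtype.val (congrFun (LinearMap.mem_ker.1 x.2) ⟨y, hy⟩)
      | zero => simp
      | add a b ha hb h1 h2 =>
        rw [add_smul]
        exact Submodule.add_mem _ h1 h2
      | smul r a ha h1 =>
        rw [smul_assoc]
        rw [Submodule.mem_bot] at h1 ⊢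
        rw [h1, smul_zero]
    let i : LinearMap.ker g →ₗ[R] M :=
      { toFun := fun x => ⟨_, hk x⟩
        map_add' := fun _ _ => rfl
        map_smul' := fun _ _ => rfl }
    have : Module.Finite R (LinearMap.ker g) :=
      Module.Finite.of_injective i fun x y h =>
        Subtype.ext (Subtype.ext (congrArg (fun z : M => (z : E)) h))
    have : Module.Finite R ((K W) ⧸ LinearMap.ker g) :=
      Module.Finite.equiv g.quotKerEquivRange.symm
    exact Module.Finite.of_submodule_quotient (LinearMap.ker g)
  have hfin : ∀ n : ℕ, Module.Finite R (K^[n] ⊥ : Submodule Λ E) := by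
    intro n
    induction n with
    | zero => exact inferInstanceAs (Module.Finite R (⊥ : Submodule Λ E))
    | succ n ih => rw [Function.iterate_succ_apply']; exact hstep _ ih
  have hmem : ∀ (n : ℕ) (x : E), (∀ a ∈ J ^ n, a • x = 0) → x ∈ (K^[n] ⊥ : Submodule Λ E) := by
    intro n
    induction n with
    | zero =>
      intro x hx
      have h1 := hx 1 (by rw [Submodule.pow_zero]; exact Submodule.one_le.1 le_rfl)
      rw [one_smul] at h1
      exact h1
    | succ n ih =>
      intro x hx
      rw [Function.iterate_succ_apply']
      intro b hb
      refine ih _ fun a ha => ?_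
      rw [← mul_smul]
      refine hx _ ?_
      rw [Submodule.pow_succ]
      exact Ideal.mul_mem_mul ha hb
  obtain ⟨n, hn⟩ := IsSemiprimaryRing.isNilpotent (R := Λ)
  have htop : (K^[n] ⊥ : Submodule Λ E) = ⊤ := by
    rw [eq_top_iff]
    intro x _
    refine hmem n x fun a ha => ?_
    have : a ∈ (0 : Ideal Λ) := hn ▸ ha
    rw [show a = 0 by simpa using this, zero_smul]
  have h1 := hfin n
  rw [htop] at h1
  have : Module.Finite R E :=
    Module.Finite.equiv ((Submodule.topEquiv (R := Λ) (M := E)).restrictScalars R)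
  exact Module.Finite.of_restrictScalars_finite R Λ E

/-- Over an artin algebra (an algebra that is finite over a commutative artinian ring), every
finitely generated module embeds into a finitely generated injective module. -/
theorem exists_fg_injective (R : Type v) {Λ : Type u} [CommRing R] [IsArtinianRing R] [Ring Λ]
    [Algebra R Λ] [Module.Finite R Λ] (M : Type u) [AddCommGroup M] [Module Λ M]
    [Module.Finite Λ M] :
    ∃ (I : FGModuleCat.{u} Λ) (f : M →ₗ[Λ] I), Module.Injective Λ I ∧ Function.Injective f := by
  obtain ⟨⟨E, hE, f, hf⟩⟩ := CategoryTheory.EnoughInjectives.presentation (ModuleCat.of Λ M)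
  have hf' : Function.Injective f.hom := (ModuleCat.mono_iff_injective f).1 hf
  have : Module.Injective Λ E := Module.injective_module_of_injective_object Λ E
  obtain ⟨U, hMU, hU, hess⟩ := exists_essential_injective (LinearMap.range f.hom)
  have : Module.Finite Λ ((LinearMap.range f.hom).comap U.subtype) := by
    let e : (LinearMap.range f.hom) →ₗ[Λ] ((LinearMap.range f.hom).comap U.subtype) :=
      LinearMap.codRestrict _ (Submodule.inclusion hMU) fun x => x.2
    refine Module.Finite.of_surjective e fun x => ⟨⟨x.1.1, x.2⟩, rfl⟩
  have : Module.Finite Λ U := by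
    refine finite_of_essential R ((LinearMap.range f.hom).comap U.subtype) fun N hN => ?_
    have h1 : N.map U.subtype = ⊥ := by
      refine hess _ (Submodule.map_subtype_le U N) ?_
      rw [Submodule.eq_bot_iff]
      rintro x ⟨⟨y, hy, rfl⟩, hx⟩
      have : y ∈ N ⊓ (LinearMap.range f.hom).comap U.subtype := ⟨hy, hx⟩
      rw [hN] at this
      simpa using this
    rw [Submodule.eq_bot_iff]
    intro x hx
    have : (x : E) ∈ N.map U.subtype := ⟨x, hx, rfl⟩
    rw [h1] at this
    exact Subtype.ext this
  refine ⟨FGModuleCat.of Λ U, f.hom.codRestrict U fun x => hMU ⟨x, rfl⟩, hU, fun x y h => ?_⟩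
  exact hf' (congrArg Subtype.val h)

open CategoryTheory

/-- The relations defining the Grothendieck group `K₀` of `mod Λ` modulo injectives:
`[C] = [A] + [B]` whenever `C ≃ A ⊕ B`, and `[I] = 0` for `I` injective. All modules are
finitely generated left `Λ`-modules. -/
def injStableRelations (Λ : Type u) [Ring Λ] : Set (FreeAbelianGroup (FGModuleCat.{u} Λ)) :=
  {x | (∃ A B C : FGModuleCat.{u} Λ, Nonempty (C ≃ₗ[Λ] A × B) ∧
          x = FreeAbelianGroup.of C - (FreeAbelianGroup.of A + FreeAbelianGroup.of B)) ∨
       (∃ I : FGModuleCat.{u} Λ, Module.Injective Λ I ∧ x = FreeAbelianGroup.of I)}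

/-- The group `K₀` (injective version): generated by the symbols `[M]`, `M` in `mod Λ`, modulo
`[C] = [A] + [B]` if `C ≃ A ⊕ B` and `[I] = 0` if `I` is injective. -/
abbrev InjStableK0 (Λ : Type u) [Ring Λ] : Type (u + 1) :=
  FreeAbelianGroup (FGModuleCat.{u} Λ) ⧸ AddSubgroup.closure (injStableRelations Λ)

/-- The class `[M]` of a finitely generated module `M` in `K₀`. -/
def injStableClass {Λ : Type u} [Ring Λ] (M : FGModuleCat.{u} Λ) : InjStableK0 Λ :=
  QuotientAddGroup.mk (FreeAbelianGroup.of M)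

/-- `Ω` is the endomorphism of `K₀` induced by the cosyzygy: `Ω [M] = [C]` for every short exact
sequence `0 → M → I → C → 0` of finitely generated modules with `I` injective, in particular when
`M → I` is an injective envelope and `C = Ω⁻¹ M` is the (minimal) cosyzygy. -/
def IsCosyzygyHom {Λ : Type u} [Ring Λ] (Ω : AddMonoid.End (InjStableK0 Λ)) : Prop :=
  ∀ (M I C : FGModuleCat.{u} Λ) (f : M →ₗ[Λ] I) (g : I →ₗ[Λ] C), Module.Injective Λ I →
    Function.Injective f → Function.Exact f g → Function.Surjective g →
      Ω (injStableClass M) = injStableClass C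

theorem injStableClass_add {Λ : Type u} [Ring Λ] {A B C : FGModuleCat.{u} Λ}
    (e : C ≃ₗ[Λ] A × B) : injStableClass C = injStableClass A + injStableClass B := by
  refine (QuotientAddGroup.eq_iff_sub_mem).2 ?_
  exact AddSubgroup.subset_closure (Or.inl ⟨A, B, C, ⟨e⟩, rfl⟩)

theorem injStableClass_injective {Λ : Type u} [Ring Λ] (I : FGModuleCat.{u} Λ)
    (hI : Module.Injective Λ I) : injStableClass I = 0 :=
  (QuotientAddGroup.eq_zero_iff _).2 (AddSubgroup.subset_closure (Or.inr ⟨I, hI, rfl⟩))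

theorem injStableClass_schanuel {Λ : Type u} [Ring Λ] {M I C I' C' : FGModuleCat.{u} Λ}
    (f : M →ₗ[Λ] I) (g : I →ₗ[Λ] C) (f' : M →ₗ[Λ] I') (g' : I' →ₗ[Λ] C')
    (hI : Module.Injective Λ I) (hI' : Module.Injective Λ I')
    (hf : Function.Injective f) (hfg : Function.Exact f g) (hg : Function.Surjective g)
    (hf' : Function.Injective f') (hfg' : Function.Exact f' g') (hg' : Function.Surjective g') :
    injStableClass C = injStableClass C' := by
  obtain ⟨h, hh⟩ := Module.Injective.out (Q := I') f hf f'
  obtain ⟨k, hk⟩ := Module.Injective.out (Q := I) f' hf' f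
  let a : (I × I') →ₗ[Λ] (C × I') :=
    (g ∘ₗ LinearMap.fst Λ I I').prod (h ∘ₗ LinearMap.fst Λ I I' - LinearMap.snd Λ I I')
  let b : (I × I') →ₗ[Λ] (C' × I) :=
    (g' ∘ₗ LinearMap.snd Λ I I').prod (k ∘ₗ LinearMap.snd Λ I I' - LinearMap.fst Λ I I')
  have ha : Function.Surjective a := by
    rintro ⟨c, y⟩
    obtain ⟨x, rfl⟩ := hg c
    exact ⟨(x, h x - y), by simp [a]⟩
  have hb : Function.Surjective b := by
    rintro ⟨c, y⟩
    obtain ⟨x, rfl⟩ := hg' c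
    exact ⟨(k x - y, x), by simp [b]⟩
  have hker : LinearMap.ker a = LinearMap.ker b := by
    ext ⟨x, y⟩
    have h1 : (x, y) ∈ LinearMap.ker a ↔ g x = 0 ∧ h x = y := by
      rw [← sub_eq_zero (a := h x)]; exact Prod.mk_eq_zero
    have h2 : (x, y) ∈ LinearMap.ker b ↔ g' y = 0 ∧ k y = x := by
      rw [← sub_eq_zero (a := k y)]; exact Prod.mk_eq_zero
    rw [h1, h2]
    constructor
    · rintro ⟨h1, h2⟩
      obtain ⟨m, rfl⟩ := (hfg x).1 h1
      rw [hh] at h2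
      subst h2
      exact ⟨(hfg' _).2 ⟨m, rfl⟩, hk m⟩
    · rintro ⟨h1, h2⟩
      obtain ⟨m, rfl⟩ := (hfg' y).1 h1
      rw [hk] at h2
      subst h2
      exact ⟨(hfg _).2 ⟨m, rfl⟩, hh m⟩
  let e : (C × I') ≃ₗ[Λ] (C' × I) :=
    (a.quotKerEquivOfSurjective ha).symm ≪≫ₗ Submodule.quotEquivOfEq _ _ hker ≪≫ₗ
      b.quotKerEquivOfSurjective hb
  have h1 := injStableClass_add (C := FGModuleCat.of Λ (C × I')) (LinearEquiv.refl Λ (C × I'))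
  have h2 := injStableClass_add (C := FGModuleCat.of Λ (C × I')) (A := C') (B := I) e
  rw [injStableClass_injective I' hI', add_zero] at h1
  rw [injStableClass_injective I hI, add_zero] at h2
  rw [← h1, h2]

/-- Over an artin algebra the cosyzygy induces a well-defined endomorphism of `K₀`, and it is
uniquely determined. -/
theorem existsUnique_isCosyzygyHom (R : Type v) (Λ : Type u) [CommRing R] [IsArtinianRing R]
    [Ring Λ] [Algebra R Λ] [Module.Finite R Λ] :
    ∃! Ω : AddMonoid.End (InjStableK0 Λ), IsCosyzygyHom Ω := by
  have hex := fun M : FGModuleCat.{u} Λ => exists_fg_injective R (Λ := Λ) M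
  choose I f hI hf using hex
  let C : FGModuleCat.{u} Λ → FGModuleCat.{u} Λ := fun M =>
    FGModuleCat.of Λ (I M ⧸ LinearMap.range (f M))
  let g : ∀ M : FGModuleCat.{u} Λ, I M →ₗ[Λ] C M := fun M => (LinearMap.range (f M)).mkQ
  have hg : ∀ M, Function.Surjective (g M) := fun M => Submodule.mkQ_surjective _
  have hfg : ∀ M, Function.Exact (f M) (g M) := fun M => LinearMap.exact_map_mkQ_range (f M)
  let φ : FreeAbelianGroup (FGModuleCat.{u} Λ) →+ InjStableK0 Λ :=
    FreeAbelianGroup.lift fun M => injStableClass (C M)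
  have hφ : AddSubgroup.closure (injStableRelations Λ) ≤ φ.ker := by
    rw [AddSubgroup.closure_le]
    rintro x (⟨A, B, D, ⟨e⟩, rfl⟩ | ⟨J, hJ, rfl⟩)
    · have hAB : Module.Injective Λ (I A × I B) := ⟨fun X Y _ _ _ _ i hi q => by
        obtain ⟨a, ha⟩ := Module.Injective.out (Q := I A) i hi (LinearMap.fst Λ _ _ ∘ₗ q)
        obtain ⟨b, hb⟩ := Module.Injective.out (Q := I B) i hi (LinearMap.snd Λ _ _ ∘ₗ q)
        exact ⟨a.prod b, fun x => Prod.ext (ha x) (hb x)⟩⟩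
      have h1 := injStableClass_schanuel (I' := FGModuleCat.of Λ (I A × I B))
        (C' := FGModuleCat.of Λ (C A × C B)) (f D) (g D)
        (((f A).prodMap (f B)) ∘ₗ e.toLinearMap) ((g A).prodMap (g B)) (hI D) hAB (hf D) (hfg D)
        (hg D) (((hf A).prodMap (hf B)).comp e.injective)
        (fun x => by
          constructor
          · intro h
            obtain ⟨a, ha⟩ := (hfg A x.1).1 (congrArg Prod.fst h)
            obtain ⟨b, hb⟩ := (hfg B x.2).1 (congrArg Prod.snd h)
            exact ⟨e.symm (a, b), by simp [ha, hb]⟩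
          · rintro ⟨y, rfl⟩
            exact Prod.ext ((hfg A _).2 ⟨_, rfl⟩) ((hfg B _).2 ⟨_, rfl⟩))
        ((hg A).prodMap (hg B))
      have h2 := injStableClass_add (C := FGModuleCat.of Λ (C A × C B)) (A := C A) (B := C B)
        (LinearEquiv.refl Λ (C A × C B))
      simp [φ, h1, h2]
    · have h1 := injStableClass_schanuel (I' := J) (C' := FGModuleCat.of Λ PUnit) (f J) (g J)
        LinearMap.id 0 (hI J) hJ (hf J) (hfg J) (hg J) (fun _ _ h => h)
        (fun x => ⟨fun _ => ⟨x, rfl⟩, fun _ => rfl⟩) (fun _ => ⟨0, rfl⟩)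
      have h2 := injStableClass_injective (FGModuleCat.of Λ PUnit)
        (⟨fun X Y _ _ _ _ _ _ _ => ⟨0, fun _ => rfl⟩⟩ : Module.Injective Λ PUnit.{u + 1})
      simp [φ, h1, h2]
  refine ⟨QuotientAddGroup.lift _ φ hφ, ?_, ?_⟩
  · intro M J D i p hJ hi hip hp
    have h0 : QuotientAddGroup.lift _ φ hφ (injStableClass M) = injStableClass (C M) := by
      simp [injStableClass, φ]
    exact h0.trans
      (injStableClass_schanuel (f M) (g M) i p (hI M) hJ (hf M) (hfg M) (hg M) hi hip hp)
  · intro Ω hΩ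
    refine QuotientAddGroup.addMonoidHom_ext _ (FreeAbelianGroup.lift_ext _ _ fun M => ?_)
    have h0 := hΩ M (I M) (C M) (f M) (g M) (hI M) (hf M) (hfg M) (hg M)
    refine h0.trans ?_
    simp [φ]

open scoped Classical in
/-- The endomorphism of `K₀` induced by the cosyzygy `Ω⁻¹`. It exists and is unique over an artin
algebra; over a ring where no such endomorphism exists the value is the meaningless `0`. -/
noncomputable def cosyzygyHom (Λ : Type u) [Ring Λ] : AddMonoid.End (InjStableK0 Λ) :=
  if h : ∃ Ω : AddMonoid.End (InjStableK0 Λ), IsCosyzygyHom Ω then h.choose else 0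

theorem cosyzygyHom_spec (R : Type v) (Λ : Type u) [CommRing R] [IsArtinianRing R]
    [Ring Λ] [Algebra R Λ] [Module.Finite R Λ] : IsCosyzygyHom (cosyzygyHom Λ) := by
  have h := (existsUnique_isCosyzygyHom R Λ).exists
  rw [cosyzygyHom, dif_pos h]
  exact h.choose_spec

/-- The subgroup `⟨add M⟩` of `K₀` generated by the classes of the direct summands of `M`
(equivalently, of the indecomposable direct summands, since every finitely generated module over an
artin algebra is a finite direct sum of indecomposable ones). -/
def addClosure {Λ : Type u} [Ring Λ] (M : FGModuleCat.{u} Λ) : AddSubgroup (InjStableK0 Λ) :=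
  AddSubgroup.closure
    {x | ∃ X Y : FGModuleCat.{u} Λ, Nonempty (M ≃ₗ[Λ] X × Y) ∧ x = injStableClass X}

/-- The subgroup `Ω⁻ˢ⟨add M⟩` of `K₀`. -/
noncomputable def cosyzygyImage {Λ : Type u} [Ring Λ] (M : FGModuleCat.{u} Λ) (s : ℕ) :
    AddSubgroup (InjStableK0 Λ) :=
  (addClosure M).map (cosyzygyHom Λ ^ s : AddMonoid.End (InjStableK0 Λ))

/-- The right Igusa–Todorov function `φ_r(M)`: the smallest `n` such that
`Ω⁻¹ : Ω⁻ˢ⟨add M⟩ → Ω⁻⁽ˢ⁺¹⁾⟨add M⟩` is an isomorphism for all `s ≥ n` (`⊤` if there were none). -/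
noncomputable def phiR {Λ : Type u} [Ring Λ] (M : FGModuleCat.{u} Λ) : ℕ∞ :=
  ⨅ n ∈ {n : ℕ | ∀ s ≥ n,
    Set.BijOn (cosyzygyHom Λ) (cosyzygyImage M s) (cosyzygyImage M (s + 1))}, (n : ℕ∞)

/-- `φ_r dim Λ`, the supremum of `φ_r(M)` over all finitely generated left modules `M`. -/
noncomputable def phiRDim (Λ : Type u) [Ring Λ] : ℕ∞ :=
  ⨆ M : FGModuleCat.{u} Λ, phiR M

/-- Projective dimension of a left `Λ`-module with values in `ℕ ∪ {∞}`; the zero module has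
projective dimension `0`. -/
noncomputable def pdim (Λ : Type u) [Ring Λ] (M : ModuleCat.{u} Λ) : ℕ∞ :=
  (projectiveDimension M).unbotD 0

/-- Global dimension of `Λ`: the supremum of the projective dimensions of the finitely generated
left modules. -/
noncomputable def gldim (Λ : Type u) [Ring Λ] : ℕ∞ :=
  ⨆ M : FGModuleCat.{u} Λ, pdim Λ M.obj

/-- `Λ/𝔄` as a right `Λ`-module, that is, as a left module over `Λᵐᵒᵖ`. -/
noncomputable def rightQuotient {Λ : Type u} [Ring Λ] (𝔄 : Ideal Λ) [𝔄.IsTwoSided] :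
    ModuleCat.{u} Λᵐᵒᵖ :=
  (ModuleCat.restrictScalars (Ideal.Quotient.mk 𝔄).op).obj
    (ModuleCat.of (Λ ⧸ 𝔄)ᵐᵒᵖ (Λ ⧸ 𝔄))

/-- The trace `τ_P Λ` of `P` in `Λ`: the left ideal generated by the images of all homomorphisms
`P → Λ`. -/
def traceInRing (Λ : Type u) [Ring Λ] (P : Type u) [AddCommGroup P] [Module Λ P] : Ideal Λ :=
  ⨆ f : P →ₗ[Λ] Λ, LinearMap.range f

theorem restrictScalars_map_exact {A B : Type u} [Ring A] [Ring B] (f : A →+* B)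
    (S : ShortComplex (ModuleCat.{u} B)) (h : S.Exact) :
    (S.map (ModuleCat.restrictScalars.{u} f)).Exact := by
  rw [CategoryTheory.ShortComplex.ShortExact.moduleCat_exact_iff_function_exact] at h ⊢
  exact h

/-- Restriction of scalars is an exact functor. -/
instance restrictScalars_preservesFiniteLimits {A B : Type u} [Ring A] [Ring B] (f : A →+* B) :
    Limits.PreservesFiniteLimits (ModuleCat.restrictScalars.{u} f) := by
  have := ((CategoryTheory.Functor.exact_tfae (ModuleCat.restrictScalars.{u} f)).out 1 3).mp
    (restrictScalars_map_exact f)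
  exact this.1

instance restrictScalars_preservesFiniteColimits {A B : Type u} [Ring A] [Ring B] (f : A →+* B) :
    Limits.PreservesFiniteColimits (ModuleCat.restrictScalars.{u} f) := by
  have := ((CategoryTheory.Functor.exact_tfae (ModuleCat.restrictScalars.{u} f)).out 1 3).mp
    (restrictScalars_map_exact f)
  exact this.2

/-- A two-sided ideal `𝔄` is a strong idempotent ideal if it is idempotent and the canonical map
`Ext^i_{Λ/𝔄}(X, Y) → Ext^i_Λ(X, Y)`, induced by the restriction functor
`mod Λ/𝔄 → mod Λ`, is an isomorphism for all `i ≥ 0` and all finitely generated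
`Λ/𝔄`-modules `X`, `Y`. -/
structure IsStrongIdempotentIdeal {Λ : Type u} [Ring Λ] (𝔄 : Ideal Λ) [𝔄.IsTwoSided] :
    Prop where
  idempotent : IsIdempotentElem 𝔄
  ext_bijective : ∀ (X Y : FGModuleCat.{u} (Λ ⧸ 𝔄)) (i : ℕ), Function.Bijective
    ((ModuleCat.restrictScalars.{u} (Ideal.Quotient.mk 𝔄)).mapExtAddHom X.obj Y.obj i)

/-! ### Ext vanishing, lifting and injective dimension along short exact sequences. -/

section ShortExactSequences

open Abelian

variable {Λ : Type u} [Ring Λ] {A B C : Type u} [AddCommGroup A] [Module Λ A] [AddCommGroup B]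
  [Module Λ B] [AddCommGroup C] [Module Λ C] {f : A →ₗ[Λ] B} {g : B →ₗ[Λ] C}

/-! Let r and d be the projective dimensions of Λ/𝔄 on the left and on the right, l = gld(Λ/𝔄), k =
l + d and n = φ_r dim Γ, all assumed finite. Put F = Hom_Λ(P, -) and G = Hom_Γ(Hom_Λ(P, Λ), -). For
s ≥ r + max(k, n), every x in K₀(Λ) killed by Ω⁻⁽ˢ⁺¹⁾ is already killed by Ω⁻ˢ; this is seen by
carrying x to K₀(Γ) and back.

The transfer works on perpendicular modules, those N with Ext^i(Λ/𝔄, N) = 0 for all i ≥ 0. For them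
N ≅ GFN (`IsTracePerpendicular.unit_bijective`). Since FG ≅ id and G preserves injectives, N embeds
into an injective GJ with perpendicular cokernel, and F turns this sequence into a cosyzygy sequence
over Γ (`IsTracePerpendicular.exists_cosyzygy`). Hence cosyzygies of perpendicular modules can be
computed on either side.

Every module becomes perpendicular at a bounded cost. After r cosyzygies the positive Ext groups
from Λ/𝔄 vanish; then the largest submodule killed by 𝔄 is divided out
(`exists_isTracePerpendicular`). That submodule has injective dimension at most k over Λ
(`hasInjectiveDimensionLE_of_annihilated`), so the division is invisible after k further cosyzygies
(`cosyzygyHom_pow_eq_of_exact`).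

There is no reason for F to preserve injectives, so F itself is not used as a map on K₀(Λ). But k
cosyzygies over Γ kill the class of FI for I injective, so Ω⁻ᵏF is defined on K₀(Λ)
(`cosyzygyHom_pow_homObj_congr`), while G descends directly (`coinducedHom`). Now write x = [A] -
[B] and t = s - r, with perpendicular replacements A', B'. The equality Ω⁻⁽ᵗ⁺¹⁾[A'] = Ω⁻⁽ᵗ⁺¹⁾[B']
yields Ω⁻⁽ᵗ⁺¹⁺ᵏ⁾([FA'] - [FB']) = 0 over Γ. As t ≥ n, the exponent drops to t, and G brings the
equality back to Ω⁻ᵗ[A'] = Ω⁻ᵗ[B']. -/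

theorem ModuleCat.shortExact_of_exact (hf : Function.Injective f) (hfg : Function.Exact f g)
    (hg : Function.Surjective g) :
    (ModuleCat.shortComplexOfCompEqZero f g hfg.linearMap_comp_eq_zero).ShortExact :=
  ModuleCat.shortComplex_shortExact _ hfg hf hg

theorem ModuleCat.subsingleton_ext_right_of_exact (hf : Function.Injective f)
    (hfg : Function.Exact f g) (hg : Function.Surjective g) (T : ModuleCat.{u} Λ) {i : ℕ}
    (hB : Subsingleton (Ext T (ModuleCat.of Λ B) i))
    (hA : Subsingleton (Ext T (ModuleCat.of Λ A) (i + 1))) :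
    Subsingleton (Ext T (ModuleCat.of Λ C) i) := by
  refine subsingleton_of_forall_eq 0 fun x => ?_
  obtain ⟨y, rfl⟩ := Ext.covariant_sequence_exact₃ T (ModuleCat.shortExact_of_exact hf hfg hg) x rfl
    (hA.elim _ _)
  rw [show y = 0 from hB.elim _ _, Ext.zero_comp]

theorem ModuleCat.exists_lift_of_subsingleton_ext (hf : Function.Injective f)
    (hfg : Function.Exact f g) (hg : Function.Surjective g) {T : Type u} [AddCommGroup T]
    [Module Λ T] (hA : Subsingleton (Ext (ModuleCat.of Λ T) (ModuleCat.of Λ A) 1))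
    (h : T →ₗ[Λ] C) : ∃ k : T →ₗ[Λ] B, g ∘ₗ k = h := by
  obtain ⟨y, hy⟩ := Ext.covariant_sequence_exact₃ (ModuleCat.of Λ T)
    (ModuleCat.shortExact_of_exact hf hfg hg) (Ext.mk₀ (ModuleCat.ofHom h)) (zero_add 1)
    (hA.elim _ _)
  obtain ⟨k, rfl⟩ := Ext.homEquiv₀.symm.surjective y
  refine ⟨k.hom, ?_⟩
  have : k ≫ ModuleCat.ofHom g = ModuleCat.ofHom h :=
    Ext.homEquiv₀.symm.injective (by simpa using hy)
  exact congrArg ModuleCat.Hom.hom this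

theorem ModuleCat.exists_extension_of_subsingleton_ext (hf : Function.Injective f)
    (hfg : Function.Exact f g) (hg : Function.Surjective g) {Y : Type u} [AddCommGroup Y]
    [Module Λ Y] (hC : Subsingleton (Ext (ModuleCat.of Λ C) (ModuleCat.of Λ Y) 1))
    (h : A →ₗ[Λ] Y) : ∃ k : B →ₗ[Λ] Y, k ∘ₗ f = h := by
  obtain ⟨y, hy⟩ := Ext.contravariant_sequence_exact₁
    (ModuleCat.shortExact_of_exact hf hfg hg) _ (Ext.mk₀ (ModuleCat.ofHom h)) (add_zero 1)
    (hC.elim _ _)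
  obtain ⟨k, rfl⟩ := Ext.homEquiv₀.symm.surjective y
  refine ⟨k.hom, ?_⟩
  have : ModuleCat.ofHom f ≫ k = ModuleCat.ofHom h :=
    Ext.homEquiv₀.symm.injective (by simpa using hy)
  exact congrArg ModuleCat.Hom.hom this

/-- Baer's criterion only tests inclusions of left ideals, whose cokernels are cyclic. This is why a
global dimension defined through finitely generated modules controls arbitrary ones. -/
theorem Module.injective_of_subsingleton_ext_one (Q : Type u) [AddCommGroup Q] [Module Λ Q]
    (h : ∀ X : FGModuleCat.{u} Λ, Subsingleton (Ext X.obj (ModuleCat.of Λ Q) 1)) :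
    Module.Injective Λ Q := by
  refine Module.Baer.injective fun I φ => ?_
  obtain ⟨k, hk⟩ := ModuleCat.exists_extension_of_subsingleton_ext (f := I.subtype) (g := I.mkQ)
    I.subtype_injective (LinearMap.exact_subtype_mkQ I) I.mkQ_surjective
    (h (FGModuleCat.of Λ (Λ ⧸ I))) φ
  exact ⟨k, fun x hx => LinearMap.congr_fun hk ⟨x, hx⟩⟩

theorem ModuleCat.subsingleton_ext_of_injective (T : ModuleCat.{u} Λ) (I : Type u) [AddCommGroup I]
    [Module Λ I] [Module.Injective Λ I] (i : ℕ) :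
    Subsingleton (Ext T (ModuleCat.of Λ I) (i + 1)) := by
  have := Module.injective_object_of_injective_module Λ I
  exact subsingleton_of_forall_eq 0 fun x => x.eq_zero_of_injective

theorem ModuleCat.exists_injective_embedding (M : Type u) [AddCommGroup M] [Module Λ M] :
    ∃ (I : ModuleCat.{u} Λ) (f : M →ₗ[Λ] I), Module.Injective Λ I ∧ Function.Injective f := by
  obtain ⟨⟨E, hE, f, hf⟩⟩ := EnoughInjectives.presentation (ModuleCat.of Λ M)
  exact ⟨E, f.hom, Module.injective_module_of_injective_object Λ E,
    (ModuleCat.mono_iff_injective f).1 hf⟩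

/-- Induction on `l` for the modules `Y` with `Ext^(l+1)(X, Y) = 0` for all finitely generated `X`,
along injective coresolutions. -/
theorem Module.injective_coresolution_induction {motive : ℕ → ModuleCat.{u} Λ → Prop}
    (hinj : ∀ Q : ModuleCat.{u} Λ, Module.Injective Λ Q → motive 0 Q)
    (hstep : ∀ (l : ℕ) (A I C : ModuleCat.{u} Λ) (f : A →ₗ[Λ] I) (g : I →ₗ[Λ] C),
      Function.Injective f → Function.Exact f g → Function.Surjective g →
        Module.Injective Λ I → motive l C → motive (l + 1) A)
    (l : ℕ) (Y : ModuleCat.{u} Λ)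
    (h : ∀ X : FGModuleCat.{u} Λ, Subsingleton (Ext X.obj Y (l + 1))) : motive l Y := by
  induction l generalizing Y with
  | zero => exact hinj Y (Module.injective_of_subsingleton_ext_one Y h)
  | succ l ih =>
    obtain ⟨I, f, hI, hf⟩ := ModuleCat.exists_injective_embedding (Λ := Λ) Y
    have hfg := LinearMap.exact_map_mkQ_range f
    refine hstep l Y I (ModuleCat.of Λ (I ⧸ LinearMap.range f)) f (LinearMap.range f).mkQ hf hfg
      (Submodule.mkQ_surjective _) hI (ih _ fun X => ?_)
    exact ModuleCat.subsingleton_ext_right_of_exact hf hfg (Submodule.mkQ_surjective _) _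
      (ModuleCat.subsingleton_ext_of_injective _ _ _) (h X)

theorem ModuleCat.hasInjectiveDimensionLE_quotient {k : ℕ} (hf : Function.Injective f)
    (hfg : Function.Exact f g) (hg : Function.Surjective g) (hB : Module.Injective Λ B)
    (hA : HasInjectiveDimensionLE (ModuleCat.of Λ A) (k + 1)) :
    HasInjectiveDimensionLE (ModuleCat.of Λ C) k := by
  have := Module.injective_object_of_injective_module Λ B
  exact (ModuleCat.shortExact_of_exact hf hfg hg).hasInjectiveDimensionLT_X₃ (k + 1)
    (hasInjectiveDimensionLT_of_ge _ 1 _ (by lia)) hA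

theorem ModuleCat.injective_of_hasInjectiveDimensionLE_zero
    (h : HasInjectiveDimensionLE (ModuleCat.of Λ A) 0) : Module.Injective Λ A := by
  have : Injective (ModuleCat.of Λ A) := injective_iff_hasInjectiveDimensionLT_one.2 h
  exact Module.injective_module_of_injective_object Λ A

theorem ModuleCat.hasInjectiveDimensionLE_of_injective (k : ℕ) [Module.Injective Λ A] :
    HasInjectiveDimensionLE (ModuleCat.of Λ A) k := by
  have := Module.injective_object_of_injective_module Λ A
  exact hasInjectiveDimensionLT_of_ge _ 1 _ (by lia)

end ShortExactSequences

theorem hasProjectiveDimensionLE_of_pdim_le {Λ : Type u} [Ring Λ] {M : ModuleCat.{u} Λ} {n : ℕ}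
    (h : pdim Λ M ≤ n) : HasProjectiveDimensionLE M n := by
  rw [← projectiveDimension_le_iff]
  revert h
  rw [pdim]
  generalize projectiveDimension M = x
  cases x with
  | bot => simp
  | coe x => intro h; exact WithBot.coe_le_coe.2 h

/-! ### Calculus in K₀ and a kernel criterion for φ_r. -/

section StableGrothendieckGroup

variable {Λ : Type u} [Ring Λ]

theorem injStableClass_prod (A B : Type u) [AddCommGroup A] [Module Λ A] [Module.Finite Λ A]
    [AddCommGroup B] [Module Λ B] [Module.Finite Λ B] :
    injStableClass (FGModuleCat.of Λ (A × B)) =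
      injStableClass (FGModuleCat.of Λ A) + injStableClass (FGModuleCat.of Λ B) :=
  injStableClass_add (C := FGModuleCat.of Λ (A × B)) (A := FGModuleCat.of Λ A)
    (B := FGModuleCat.of Λ B) (LinearEquiv.refl Λ (A × B))

theorem injStableClass_subsingleton (A : FGModuleCat.{u} Λ) [Subsingleton A] :
    injStableClass A = 0 :=
  injStableClass_injective A ⟨fun _ _ _ _ _ _ _ _ _ => ⟨0, fun _ => Subsingleton.elim _ _⟩⟩

theorem injStableClass_congr {A B : FGModuleCat.{u} Λ} (e : A ≃ₗ[Λ] B) :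
    injStableClass A = injStableClass B := by
  have h := injStableClass_add (A := B) (B := FGModuleCat.of Λ PUnit) (C := A)
    (e ≪≫ₗ (LinearEquiv.prodUnique (R := Λ) (M := B) (M₂ := PUnit.{u + 1})).symm)
  have : Subsingleton (FGModuleCat.of Λ PUnit.{u + 1}) := inferInstanceAs (Subsingleton PUnit)
  rwa [injStableClass_subsingleton (FGModuleCat.of Λ PUnit), add_zero] at h

/-- Direct sums collect the positive generators into one module and the negative ones into another.
-/
theorem exists_eq_injStableClass_sub (x : InjStableK0 Λ) :
    ∃ A B : FGModuleCat.{u} Λ, x = injStableClass A - injStableClass B := by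
  obtain ⟨y, rfl⟩ := QuotientAddGroup.mk_surjective x
  have h0 : injStableClass (FGModuleCat.of Λ PUnit.{u + 1}) = 0 :=
    have : Subsingleton (FGModuleCat.of Λ PUnit.{u + 1}) := inferInstanceAs (Subsingleton PUnit)
    injStableClass_subsingleton (FGModuleCat.of Λ PUnit)
  induction y using FreeAbelianGroup.induction_on with
  | zero => exact ⟨FGModuleCat.of Λ PUnit, FGModuleCat.of Λ PUnit, (sub_self _).symm⟩
  | of M => exact ⟨M, FGModuleCat.of Λ PUnit, by rw [h0, sub_zero]; rfl⟩
  | neg M => exact ⟨FGModuleCat.of Λ PUnit, M, by rw [h0, zero_sub]; rfl⟩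
  | add x y hx hy =>
    obtain ⟨A, B, h⟩ := hx
    obtain ⟨A', B', h'⟩ := hy
    refine ⟨FGModuleCat.of Λ (A × A'), FGModuleCat.of Λ (B × B'), ?_⟩
    rw [QuotientAddGroup.mk_add, h, h', injStableClass_prod, injStableClass_prod]
    abel

/-- Homomorphisms out of `K₀` are given by additive functions vanishing on injectives. -/
def InjStableK0.lift {G : Type*} [AddCommGroup G] (φ : FGModuleCat.{u} Λ → G)
    (hadd : ∀ A B C : FGModuleCat.{u} Λ, (C ≃ₗ[Λ] A × B) → φ C = φ A + φ B)
    (hinj : ∀ I : FGModuleCat.{u} Λ, Module.Injective Λ I → φ I = 0) : InjStableK0 Λ →+ G :=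
  QuotientAddGroup.lift _ (FreeAbelianGroup.lift φ) (by
    rw [AddSubgroup.closure_le]
    rintro x (⟨A, B, C, ⟨e⟩, rfl⟩ | ⟨I, hI, rfl⟩)
    · simp [hadd A B C e]
    · simp [hinj I hI])

@[simp]
theorem InjStableK0.lift_injStableClass {G : Type*} [AddCommGroup G] (φ : FGModuleCat.{u} Λ → G)
    (hadd : ∀ A B C : FGModuleCat.{u} Λ, (C ≃ₗ[Λ] A × B) → φ C = φ A + φ B)
    (hinj : ∀ I : FGModuleCat.{u} Λ, Module.Injective Λ I → φ I = 0) (M : FGModuleCat.{u} Λ) :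
    InjStableK0.lift φ hadd hinj (injStableClass M) = φ M :=
  FreeAbelianGroup.lift_apply_of φ M

/-- Surjectivity onto the next image is automatic, so only the kernel of Ω⁻¹ on each image matters.
-/
theorem phiR_le_iff (M : FGModuleCat.{u} Λ) (n : ℕ) :
    phiR M ≤ n ↔ ∀ s ≥ n, ∀ x ∈ addClosure M, (cosyzygyHom Λ ^ (s + 1)) x = 0 →
      (cosyzygyHom Λ ^ s) x = 0 := by
  have key : ∀ s, Set.BijOn (cosyzygyHom Λ) (cosyzygyImage M s) (cosyzygyImage M (s + 1)) ↔
      ∀ x ∈ addClosure M, (cosyzygyHom Λ ^ (s + 1)) x = 0 → (cosyzygyHom Λ ^ s) x = 0 := by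
    intro s
    have hs : ∀ x, (cosyzygyHom Λ ^ (s + 1)) x = cosyzygyHom Λ ((cosyzygyHom Λ ^ s) x) := fun x => by
      rw [pow_succ']; rfl
    constructor
    · intro h x hx hx0
      exact h.injOn ⟨x, hx, rfl⟩ (zero_mem _) ((hs x).symm.trans (hx0.trans (map_zero _).symm))
    · intro h
      refine ⟨?_, ?_, ?_⟩
      · rintro _ ⟨x, hx, rfl⟩
        exact ⟨x, hx, hs x⟩
      · rintro _ ⟨x, hx, rfl⟩ _ ⟨y, hy, rfl⟩ hxy
        have hxy' : (cosyzygyHom Λ ^ (s + 1)) x = (cosyzygyHom Λ ^ (s + 1)) y :=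
          (hs x).trans (hxy.trans (hs y).symm)
        exact sub_eq_zero.1 ((map_sub _ _ _).symm.trans
          (h _ (sub_mem hx hy) ((map_sub _ _ _).trans (sub_eq_zero.2 hxy'))))
      · rintro _ ⟨x, hx, rfl⟩
        exact ⟨_, ⟨x, hx, rfl⟩, (hs x).symm⟩
  simp only [← key]
  constructor
  · intro h s hs
    -- A strict bound on the infimum yields an actual index m ≤ n, whose condition covers all s ≥ n.
    have h' : phiR M < (n + 1 : ℕ) := lt_of_le_of_lt h (by exact_mod_cast Nat.lt_succ_self n)
    rw [phiR, iInf_lt_iff] at h'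
    obtain ⟨m, hm⟩ := h'
    rw [iInf_lt_iff] at hm
    obtain ⟨hm, hmn⟩ := hm
    have : m < n + 1 := by exact_mod_cast hmn
    exact hm s (by lia)
  · intro h
    exact iInf₂_le n h

variable {Ω : AddMonoid.End (InjStableK0 Λ)}

theorem IsCosyzygyHom.pow_succ_apply (hΩ : IsCosyzygyHom Ω) {M I C : FGModuleCat.{u} Λ}
    (f : M →ₗ[Λ] I) (g : I →ₗ[Λ] C) (hI : Module.Injective Λ I) (hf : Function.Injective f)
    (hfg : Function.Exact f g) (hg : Function.Surjective g) (t : ℕ) :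
    (Ω ^ (t + 1)) (injStableClass M) = (Ω ^ t) (injStableClass C) := by
  rw [pow_succ, AddMonoid.End.coe_mul, Function.comp_apply, hΩ M I C f g hI hf hfg hg]

end StableGrothendieckGroup

/-! ### Horseshoe lemma and splitting for injectives. -/

section Horseshoe

variable {Λ : Type u} [Ring Λ]

theorem Module.Injective.prod (I J : Type u) [AddCommGroup I] [Module Λ I] [AddCommGroup J]
    [Module Λ J] [Module.Injective Λ I] [Module.Injective Λ J] : Module.Injective Λ (I × J) where
  out X Y _ _ _ _ i hi q := by
    obtain ⟨a, ha⟩ := Module.Injective.out (Q := I) i hi (LinearMap.fst Λ _ _ ∘ₗ q)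
    obtain ⟨b, hb⟩ := Module.Injective.out (Q := J) i hi (LinearMap.snd Λ _ _ ∘ₗ q)
    exact ⟨a.prod b, fun x => Prod.ext (ha x) (hb x)⟩

variable {A B C I J : Type u} [AddCommGroup A] [Module Λ A] [AddCommGroup B] [Module Λ B]
  [AddCommGroup C] [Module Λ C] [AddCommGroup I] [Module Λ I] [AddCommGroup J] [Module Λ J]

/-- The injective horseshoe lemma. -/
theorem Module.Injective.horseshoe [Module.Injective Λ I] {f : A →ₗ[Λ] B} {g : B →ₗ[Λ] C}
    (hf : Function.Injective f) (hfg : Function.Exact f g) (hg : Function.Surjective g)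
    (i : A →ₗ[Λ] I) (hi : Function.Injective i) (j : C →ₗ[Λ] J) (hj : Function.Injective j) :
    ∃ (h : B →ₗ[Λ] I × J)
      (f' : (I ⧸ LinearMap.range i) →ₗ[Λ] ((I × J) ⧸ LinearMap.range h))
      (g' : ((I × J) ⧸ LinearMap.range h) →ₗ[Λ] (J ⧸ LinearMap.range j)),
      Function.Injective h ∧ Function.Injective f' ∧ Function.Exact f' g' ∧
        Function.Surjective g' := by
  obtain ⟨k, hk⟩ := Module.Injective.out (Q := I) f hf i
  let h : B →ₗ[Λ] I × J := k.prod (j ∘ₗ g)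
  have h1 : LinearMap.range i ≤ (LinearMap.range h).comap (LinearMap.inl Λ I J) := by
    rintro _ ⟨a, rfl⟩
    exact ⟨f a, Prod.ext (hk a) (by simp [h, (hfg _).2 ⟨a, rfl⟩])⟩
  have h2 : LinearMap.range h ≤ (LinearMap.range j).comap (LinearMap.snd Λ I J) := by
    rintro _ ⟨b, rfl⟩
    exact ⟨g b, rfl⟩
  refine ⟨h, Submodule.mapQ _ _ (LinearMap.inl Λ I J) h1,
    Submodule.mapQ _ _ (LinearMap.snd Λ I J) h2, ?_, ?_, ?_, ?_⟩
  · rw [← LinearMap.ker_eq_bot, Submodule.eq_bot_iff]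
    intro b hb
    have hb1 : k b = 0 := congrArg Prod.fst hb
    have hb2 : j (g b) = 0 := congrArg Prod.snd hb
    obtain ⟨a, rfl⟩ := (hfg b).1 (hj (hb2.trans (map_zero j).symm))
    rw [hk] at hb1
    rw [hi (hb1.trans (map_zero i).symm), map_zero]
  · rw [← LinearMap.ker_eq_bot, Submodule.eq_bot_iff]
    intro x hx
    obtain ⟨x, rfl⟩ := Submodule.mkQ_surjective _ x
    obtain ⟨b, hb⟩ : LinearMap.inl Λ I J x ∈ LinearMap.range h :=
      (Submodule.Quotient.mk_eq_zero _).1 hx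
    have hb2 : j (g b) = 0 := congrArg Prod.snd hb
    obtain ⟨a, rfl⟩ := (hfg b).1 (hj (hb2.trans (map_zero j).symm))
    exact (Submodule.Quotient.mk_eq_zero _).2 ⟨a, (hk a).symm.trans (congrArg Prod.fst hb)⟩
  · intro x
    obtain ⟨⟨x, y⟩, rfl⟩ := Submodule.mkQ_surjective _ x
    constructor
    · intro hx
      obtain ⟨c, hc⟩ : y ∈ LinearMap.range j := (Submodule.Quotient.mk_eq_zero _).1 hx
      obtain ⟨b, rfl⟩ := hg c
      refine ⟨Submodule.Quotient.mk (x - k b), ?_⟩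
      refine (Submodule.Quotient.eq _).2 ⟨-b, ?_⟩
      refine Prod.ext ?_ ?_
      · simp [h]
      · simp [h, hc]
    · rintro ⟨z, hz⟩
      obtain ⟨z, rfl⟩ := Submodule.mkQ_surjective _ z
      rw [← hz]
      exact map_zero (LinearMap.range j).mkQ
  · intro y
    obtain ⟨y, rfl⟩ := Submodule.mkQ_surjective _ y
    exact ⟨Submodule.Quotient.mk (0, y), rfl⟩

/-- A short exact sequence with injective kernel splits. -/
theorem Module.Injective.nonempty_equiv_prod [Module.Injective Λ A] {f : A →ₗ[Λ] B}
    {g : B →ₗ[Λ] C} (hf : Function.Injective f) (hfg : Function.Exact f g)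
    (hg : Function.Surjective g) : Nonempty (B ≃ₗ[Λ] A × C) := by
  obtain ⟨k, hk⟩ := Module.Injective.out (Q := A) f hf LinearMap.id
  refine ⟨LinearEquiv.ofBijective (k.prod g) ⟨?_, ?_⟩⟩
  · rw [← LinearMap.ker_eq_bot, Submodule.eq_bot_iff]
    intro b hb
    have hb1 : k b = 0 := congrArg Prod.fst hb
    obtain ⟨a, rfl⟩ := (hfg b).1 (congrArg Prod.snd hb)
    have : a = 0 := (hk a).symm.trans hb1
    rw [this, map_zero]
  · rintro ⟨a, c⟩
    obtain ⟨b, rfl⟩ := hg c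
    refine ⟨b + f (a - k b), Prod.ext ?_ ?_⟩
    · change k (b + f (a - k b)) = a
      rw [map_add, hk, LinearMap.id_apply, add_sub_cancel]
    · change g (b + f (a - k b)) = g b
      rw [map_add, (hfg (f (a - k b))).2 ⟨_, rfl⟩, add_zero]

end Horseshoe

/-! ### Iterated cosyzygies over an artin algebra. -/

section Cosyzygies

variable (R : Type v) [CommRing R] [IsArtinianRing R] {Λ : Type u} [Ring Λ] [Algebra R Λ]
  [Module.Finite R Λ]

include R

/-- By the horseshoe lemma the cosyzygies of A, B, C again form a short exact sequence. After k
steps its kernel is injective, so it splits and the kernel contributes 0. -/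
theorem cosyzygyHom_pow_eq_of_exact (k : ℕ) {A B C : FGModuleCat.{u} Λ} {f : A →ₗ[Λ] B}
    {g : B →ₗ[Λ] C} (hf : Function.Injective f) (hfg : Function.Exact f g)
    (hg : Function.Surjective g) (hA : HasInjectiveDimensionLE A.obj k) :
    (cosyzygyHom Λ ^ k) (injStableClass B) = (cosyzygyHom Λ ^ k) (injStableClass C) := by
  have hΩ := cosyzygyHom_spec R Λ
  induction k generalizing A B C with
  | zero =>
    have hA' : Module.Injective Λ A := ModuleCat.injective_of_hasInjectiveDimensionLE_zero hA
    obtain ⟨e⟩ := Module.Injective.nonempty_equiv_prod hf hfg hg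
    rw [injStableClass_add e, injStableClass_injective A hA', zero_add]
  | succ k ih =>
    obtain ⟨I, i, hI, hi⟩ := exists_fg_injective R (Λ := Λ) A
    obtain ⟨J, j, hJ, hj⟩ := exists_fg_injective R (Λ := Λ) C
    obtain ⟨h, f', g', hh, hf', hfg', hg'⟩ := Module.Injective.horseshoe hf hfg hg i hi j hj
    have hIJ := Module.Injective.prod (Λ := Λ) I J
    have h1 := hΩ.pow_succ_apply (M := B) (I := FGModuleCat.of Λ (I × J))
      (C := FGModuleCat.of Λ ((I × J) ⧸ LinearMap.range h)) h (LinearMap.range h).mkQ hIJ hh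
      (LinearMap.exact_map_mkQ_range h) (Submodule.mkQ_surjective _) k
    have h2 := hΩ.pow_succ_apply (M := C) (I := J)
      (C := FGModuleCat.of Λ (J ⧸ LinearMap.range j)) j (LinearMap.range j).mkQ hJ hj
      (LinearMap.exact_map_mkQ_range j) (Submodule.mkQ_surjective _) k
    rw [h1, h2]
    exact ih (A := FGModuleCat.of Λ (I ⧸ LinearMap.range i)) hf' hfg' hg'
      (ModuleCat.hasInjectiveDimensionLE_quotient hi (LinearMap.exact_map_mkQ_range i)
        (Submodule.mkQ_surjective _) hI hA)

/-- The `r`-th cosyzygy is `Ext(T, -)`-acyclic if `T` has projective dimension at most `r`. -/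
theorem exists_cosyzygy_ext_vanishing (T : ModuleCat.{u} Λ) (r : ℕ) (M : FGModuleCat.{u} Λ)
    (h : ∀ i, Subsingleton (Abelian.Ext T M.obj (r + i + 1))) :
    ∃ N : FGModuleCat.{u} Λ, (∀ i, Subsingleton (Abelian.Ext T N.obj (i + 1))) ∧
      (cosyzygyHom Λ ^ r) (injStableClass M) = injStableClass N := by
  have hΩ := cosyzygyHom_spec R Λ
  induction r generalizing M with
  | zero => exact ⟨M, fun i => by simpa only [zero_add] using h i, rfl⟩
  | succ r ih =>
    obtain ⟨I, f, hI, hf⟩ := exists_fg_injective R (Λ := Λ) M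
    obtain ⟨N, hN, hN'⟩ := ih (FGModuleCat.of Λ (I ⧸ LinearMap.range f)) fun i => by
      refine ModuleCat.subsingleton_ext_right_of_exact hf (LinearMap.exact_map_mkQ_range f)
        (Submodule.mkQ_surjective _) T (ModuleCat.subsingleton_ext_of_injective _ _ _) ?_
      have := h i
      rwa [show r + 1 + i + 1 = r + i + 1 + 1 by lia] at this
    refine ⟨N, hN, ?_⟩
    rw [← hN']
    exact hΩ.pow_succ_apply (I := I) f (LinearMap.range f).mkQ hI hf
      (LinearMap.exact_map_mkQ_range f) (Submodule.mkQ_surjective _) r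

end Cosyzygies

/-! ### Dualising right modules into left modules. -/

section CharacterDual

/-- The left `Λ`-module of additive maps from a right `Λ`-module `V` to an abelian group `D`. -/
def CharacterDual (Λ V D : Type u) [Ring Λ] [AddCommGroup V] [Module Λᵐᵒᵖ V] [AddCommGroup D] :
    Type u :=
  V →+ D

namespace CharacterDual

variable {Λ V W X D : Type u} [Ring Λ] [AddCommGroup V] [Module Λᵐᵒᵖ V] [AddCommGroup W]
  [Module Λᵐᵒᵖ W] [AddCommGroup X] [Module Λᵐᵒᵖ X] [AddCommGroup D]

instance : AddCommGroup (CharacterDual Λ V D) := inferInstanceAs (AddCommGroup (V →+ D))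

instance : FunLike (CharacterDual Λ V D) V D := inferInstanceAs (FunLike (V →+ D) V D)

instance : AddMonoidHomClass (CharacterDual Λ V D) V D :=
  inferInstanceAs (AddMonoidHomClass (V →+ D) V D)

@[ext]
theorem ext {f g : CharacterDual Λ V D} (h : ∀ v, f v = g v) : f = g := DFunLike.ext _ _ h

@[simp]
theorem add_apply (f g : CharacterDual Λ V D) (v : V) : (f + g) v = f v + g v := rfl

@[simp]
theorem zero_apply (v : V) : (0 : CharacterDual Λ V D) v = 0 := rfl

instance : Module Λ (CharacterDual Λ V D) where
  smul a f := AddMonoidHom.comp f (DistribSMul.toAddMonoidHom V (MulOpposite.op a))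
  one_smul f := ext fun v => congrArg f (one_smul _ v)
  mul_smul _ _ f := ext fun v => congrArg f (by
    simp only [DistribSMul.toAddMonoidHom_apply, MulOpposite.op_mul, mul_smul])
  smul_zero _ := rfl
  smul_add _ _ _ := rfl
  add_smul _ _ f := ext fun v => (congrArg f (add_smul _ _ v)).trans (map_add f _ _)
  zero_smul f := ext fun v => (congrArg f (zero_smul _ v)).trans (map_zero f)

@[simp]
theorem smul_apply (a : Λ) (f : CharacterDual Λ V D) (v : V) :
    (a • f) v = f (MulOpposite.op a • v) := rfl

/-- Precomposition with a linear map of right modules. -/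
def map (D : Type u) [AddCommGroup D] (f : V →ₗ[Λᵐᵒᵖ] W) :
    CharacterDual Λ W D →ₗ[Λ] CharacterDual Λ V D where
  toFun φ := AddMonoidHom.comp φ f.toAddMonoidHom
  map_add' _ _ := rfl
  map_smul' _ φ := ext fun v => congrArg φ (f.map_smul _ v).symm

theorem exists_extension [Module.Injective ℤ D] (f : V →ₗ[Λᵐᵒᵖ] W) (hf : Function.Injective f)
    (φ : CharacterDual Λ V D) : ∃ ψ : CharacterDual Λ W D, ∀ v, ψ (f v) = φ v := by
  obtain ⟨k, hk⟩ := Module.Injective.out (Q := D) (R := ℤ) f.toAddMonoidHom.toIntLinearMap hf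
    (AddMonoidHom.toIntLinearMap φ)
  exact ⟨k.toAddMonoidHom, hk⟩

/-- A map Y → Hom_ℤ(V, D) is the same as a map V → Hom_ℤ(Y, D) of right modules. Injectivity of D
makes restriction Hom_ℤ(Z, D) → Hom_ℤ(Y, D) surjective, and projectivity of V lifts along it. -/
theorem injective [Module.Injective ℤ D] [Module.Projective Λᵐᵒᵖ V] :
    Module.Injective Λ (CharacterDual Λ V D) where
  out Y Z _ _ _ _ i hi q := by
    -- additive maps out of a left module form a right module
    let _ (Y : Type u) [AddCommGroup Y] [Module Λ Y] : Module Λᵐᵒᵖ (Y →+ D) :=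
      { smul := fun a f => f.comp (DistribSMul.toAddMonoidHom Y a.unop)
        one_smul := fun f => AddMonoidHom.ext fun v => congrArg f (one_smul _ v)
        mul_smul := fun a b f => AddMonoidHom.ext fun v => congrArg f (mul_smul _ _ v)
        smul_zero := fun _ => rfl
        smul_add := fun _ _ _ => rfl
        add_smul := fun a b f => AddMonoidHom.ext fun v =>
          (congrArg f (add_smul _ _ v)).trans (map_add f _ _)
        zero_smul := fun f => AddMonoidHom.ext fun v =>
          (congrArg f (zero_smul _ v)).trans (map_zero f) }
    let ρ : (Z →+ D) →ₗ[Λᵐᵒᵖ] (Y →+ D) :=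
      { toFun := fun φ => φ.comp i.toAddMonoidHom
        map_add' := fun _ _ => rfl
        map_smul' := fun a φ => AddMonoidHom.ext fun v => congrArg φ (i.map_smul _ v).symm }
    have hρ : Function.Surjective ρ := fun φ => by
      obtain ⟨k, hk⟩ := Module.Injective.out (Q := D) (R := ℤ) i.toAddMonoidHom.toIntLinearMap hi
        φ.toIntLinearMap
      exact ⟨k.toAddMonoidHom, AddMonoidHom.ext hk⟩
    let σ : V →ₗ[Λᵐᵒᵖ] (Y →+ D) :=
      { toFun := fun v =>
          { toFun := fun y => q y v
            map_zero' := by simp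
            map_add' := by simp }
        map_add' := fun v w => AddMonoidHom.ext fun y => map_add (q y) v w
        map_smul' := fun a v => AddMonoidHom.ext fun y => by
          change q y (a • v) = q (a.unop • y) v
          simp }
    obtain ⟨τ, hτ⟩ := Module.projective_lifting_property ρ σ hρ
    refine ⟨{ toFun := fun z =>
                ({ toFun := fun v => τ v z
                   map_zero' := by simp
                   map_add' := by simp } : V →+ D)
              map_add' := fun z z' => ext fun v => map_add (τ v) z z'
              map_smul' := fun a z => ext fun v => ?_ }, fun y => ext fun v => ?_⟩
    · change τ v (a • z) = τ (MulOpposite.op a • v) z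
      exact (DFunLike.congr_fun (τ.map_smul (MulOpposite.op a) v) z).symm
    · exact DFunLike.congr_fun (LinearMap.congr_fun hτ v) y

theorem map_injective (f : V →ₗ[Λᵐᵒᵖ] W) (hf : Function.Surjective f) :
    Function.Injective (map D f) := fun φ ψ h => ext fun w => by
  obtain ⟨v, rfl⟩ := hf w
  exact DFunLike.congr_fun h v

theorem map_exact {f : V →ₗ[Λᵐᵒᵖ] W} {g : W →ₗ[Λᵐᵒᵖ] X} (hfg : Function.Exact f g)
    (hg : Function.Surjective g) : Function.Exact (map D g) (map D f) := by
  intro φ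
  constructor
  · intro h
    have hker : g.toAddMonoidHom.ker ≤ AddMonoidHom.ker φ := fun w hw => by
      obtain ⟨v, rfl⟩ := (hfg w).1 hw
      exact DFunLike.congr_fun h v
    exact ⟨g.toAddMonoidHom.liftOfSurjective hg ⟨φ, hker⟩, ext fun w =>
      g.toAddMonoidHom.liftOfRightInverse_comp_apply _ (Function.rightInverse_surjInv hg)
        ⟨φ, hker⟩ w⟩
  · rintro ⟨ψ, rfl⟩
    exact ext fun v => (congrArg ψ ((hfg (f v)).2 ⟨v, rfl⟩)).trans (map_zero ψ)

theorem map_surjective [Module.Injective ℤ D] (f : V →ₗ[Λᵐᵒᵖ] W) (hf : Function.Injective f) :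
    Function.Surjective (map D f) := fun φ =>
  (exists_extension f hf φ).imp fun _ h => ext h

/-- The dual of a projective resolution is an injective coresolution; the induction peels off one
free cover at a time. -/
theorem hasInjectiveDimensionLE [Module.Injective ℤ D] (d : ℕ)
    (hV : HasProjectiveDimensionLE (ModuleCat.of Λᵐᵒᵖ V) d) :
    HasInjectiveDimensionLE (ModuleCat.of Λ (CharacterDual Λ V D)) d := by
  induction d generalizing V with
  | zero =>
    have : Projective (ModuleCat.of Λᵐᵒᵖ V) := projective_iff_hasProjectiveDimensionLT_one.2 hV
    have := (IsProjective.iff_projective V).2 this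
    have := CharacterDual.injective (Λ := Λ) (V := V) (D := D)
    exact ModuleCat.hasInjectiveDimensionLE_of_injective 0
  | succ d ih =>
    let p : (V →₀ Λᵐᵒᵖ) →ₗ[Λᵐᵒᵖ] V := Finsupp.linearCombination Λᵐᵒᵖ id
    have hp : Function.Surjective p := Finsupp.linearCombination_id_surjective Λᵐᵒᵖ V
    have hex : Function.Exact (LinearMap.ker p).subtype p := LinearMap.exact_subtype_ker_map p
    have := (IsProjective.iff_projective (R := Λᵐᵒᵖ) (V →₀ Λᵐᵒᵖ)).1 inferInstance
    have hK : HasProjectiveDimensionLE (ModuleCat.of Λᵐᵒᵖ (LinearMap.ker p)) d :=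
      ((ModuleCat.shortExact_of_exact (LinearMap.ker p).subtype_injective hex
        hp).hasProjectiveDimensionLT_X₃_iff d this).1 hV
    have := CharacterDual.injective (Λ := Λ) (V := V →₀ Λᵐᵒᵖ) (D := D)
    have := Module.injective_object_of_injective_module Λ (CharacterDual Λ (V →₀ Λᵐᵒᵖ) D)
    exact ((ModuleCat.shortExact_of_exact (map_injective (D := D) p hp) (map_exact hex hp)
      (map_surjective _ (LinearMap.ker p).subtype_injective)).hasInjectiveDimensionLT_X₃_iff d
        this).1 (ih hK)

end CharacterDual

end CharacterDual

/-! ### Homological properties of modules annihilated by 𝔄. -/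

section TwoSidedIdeal

open Abelian

variable {Λ : Type u} [Ring Λ] (𝔄 : Ideal Λ) [𝔄.IsTwoSided]

/-- An injective `Λ/𝔄`-module has injective dimension over `Λ` at most the projective dimension of
`Λ/𝔄` as a right module. -/
theorem hasInjectiveDimensionLE_restrictScalars_of_injective {d : ℕ}
    (hd : HasProjectiveDimensionLE (rightQuotient 𝔄) d) (Q : ModuleCat.{u} (Λ ⧸ 𝔄))
    [hQ : Module.Injective (Λ ⧸ 𝔄) Q] :
    HasInjectiveDimensionLE
      ((ModuleCat.restrictScalars.{u} (Ideal.Quotient.mk 𝔄)).obj Q) d := by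
  -- With Q inside an injective abelian group D, the module Q is a retract of Hom_ℤ(Λ/𝔄, D) over
  -- Λ/𝔄. Restricted to Λ, the latter is the dual of the right Λ-module Λ/𝔄, whose projective
  -- dimension is at most d.
  obtain ⟨⟨D, hD, ι, hι⟩⟩ := EnoughInjectives.presentation (ModuleCat.of.{u} ℤ Q)
  have hD' := Module.injective_module_of_injective_object ℤ D
  have : @Module.Injective ℤ _ D _ (AddCommGroup.toIntModule D) := by
    convert hD'
    exact Subsingleton.elim _ _
  have hι' : Function.Injective ι.hom := (ModuleCat.mono_iff_injective ι).1 hι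
  let V := rightQuotient 𝔄
  let κ : Q →ₗ[Λ ⧸ 𝔄] CharacterDual (Λ ⧸ 𝔄) (Λ ⧸ 𝔄) D :=
    { toFun := fun q =>
        ({ toFun := fun b => ι.hom (b • q)
           map_zero' := by rw [zero_smul, map_zero]
           map_add' := fun b c => by rw [add_smul, map_add] } : (Λ ⧸ 𝔄) →+ D)
      map_add' := fun q q' => CharacterDual.ext fun b => by
        change ι.hom (b • (q + q')) = ι.hom (b • q) + ι.hom (b • q')
        rw [smul_add, map_add]
      map_smul' := fun a q => CharacterDual.ext fun b => by
        change ι.hom (b • a • q) = ι.hom ((b * a) • q)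
        rw [mul_smul] }
  have hκ : Function.Injective κ := fun q q' h => hι' (by
    have h1 : ι.hom ((1 : Λ ⧸ 𝔄) • q) = ι.hom ((1 : Λ ⧸ 𝔄) • q') := DFunLike.congr_fun h 1
    rwa [one_smul, one_smul] at h1)
  obtain ⟨r, hr⟩ := Module.Injective.out (Q := Q) κ hκ LinearMap.id
  let ρ : Retract Q (ModuleCat.of (Λ ⧸ 𝔄) (CharacterDual (Λ ⧸ 𝔄) (Λ ⧸ 𝔄) D)) :=
    { i := ModuleCat.ofHom κ
      r := ModuleCat.ofHom r
      retract := ModuleCat.hom_ext (LinearMap.ext hr) }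
  let W : ModuleCat.{u} Λ := (ModuleCat.restrictScalars.{u} (Ideal.Quotient.mk 𝔄)).obj
    (ModuleCat.of (Λ ⧸ 𝔄) (CharacterDual (Λ ⧸ 𝔄) (Λ ⧸ 𝔄) D))
  let e : ModuleCat.of Λ (CharacterDual Λ V D) ≃ₗ[Λ] W :=
    { toFun := fun y => y
      invFun := fun y => y
      left_inv := fun _ => rfl
      right_inv := fun _ => rfl
      map_add' := fun _ _ => rfl
      map_smul' := fun _ _ => rfl }
  have h1 : HasInjectiveDimensionLE (ModuleCat.of Λ (CharacterDual Λ V D)) d :=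
    CharacterDual.hasInjectiveDimensionLE d hd
  have h2 : HasInjectiveDimensionLE W d := hasInjectiveDimensionLT_of_iso e.toModuleIso _
  exact (ρ.map (ModuleCat.restrictScalars.{u} (Ideal.Quotient.mk 𝔄))).hasInjectiveDimensionLT _

/-- Over Λ/𝔄 there is an injective coresolution of length l, and over Λ each of its terms has
injective dimension at most d. -/
theorem hasInjectiveDimensionLE_restrictScalars {d l : ℕ}
    (hd : HasProjectiveDimensionLE (rightQuotient 𝔄) d) (hl : gldim (Λ ⧸ 𝔄) ≤ l)
    (Y : ModuleCat.{u} (Λ ⧸ 𝔄)) :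
    HasInjectiveDimensionLE
      ((ModuleCat.restrictScalars.{u} (Ideal.Quotient.mk 𝔄)).obj Y) (l + d) := by
  refine Module.injective_coresolution_induction (Λ := Λ ⧸ 𝔄) (motive := fun l Y =>
    HasInjectiveDimensionLE
      ((ModuleCat.restrictScalars.{u} (Ideal.Quotient.mk 𝔄)).obj Y) (l + d)) ?_ ?_ l Y ?_
  · intro Q hQ
    rw [zero_add]
    exact hasInjectiveDimensionLE_restrictScalars_of_injective 𝔄 hd Q
  · intro l A I C f g hf hfg hg hI hC
    have hI' := hasInjectiveDimensionLE_restrictScalars_of_injective 𝔄 hd I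
    have hS := (ModuleCat.shortExact_of_exact hf hfg hg).map_of_exact
      (ModuleCat.restrictScalars.{u} (Ideal.Quotient.mk 𝔄))
    have : HasInjectiveDimensionLE
      ((ModuleCat.restrictScalars.{u} (Ideal.Quotient.mk 𝔄)).obj A) (l + d + 1) :=
      hS.hasInjectiveDimensionLT_X₁ (l + d + 1) hC
        (hasInjectiveDimensionLT_of_ge ((ModuleCat.restrictScalars.{u} (Ideal.Quotient.mk 𝔄)).obj I)
          (d + 1) _ (by lia))
    rwa [show l + 1 + d = l + d + 1 by lia]
  · intro X
    have hX : pdim (Λ ⧸ 𝔄) X.obj ≤ l := (le_iSup (fun M : FGModuleCat.{u} (Λ ⧸ 𝔄) =>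
      pdim (Λ ⧸ 𝔄) M.obj) X).trans hl
    have := hasProjectiveDimensionLE_of_pdim_le hX
    exact HasProjectiveDimensionLT.subsingleton X.obj (l + 1) (l + 1) le_rfl Y

/-- Λ/𝔄 is projective over itself, so its higher Ext groups vanish there, and the canonical map
carries this to Λ. -/
theorem IsStrongIdempotentIdeal.subsingleton_ext_restrictScalars {𝔄 : Ideal Λ} [𝔄.IsTwoSided]
    (h𝔄 : IsStrongIdempotentIdeal 𝔄) (Y : FGModuleCat.{u} (Λ ⧸ 𝔄)) (i : ℕ) :
    Subsingleton (Ext (ModuleCat.of Λ (Λ ⧸ 𝔄))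
      ((ModuleCat.restrictScalars.{u} (Ideal.Quotient.mk 𝔄)).obj Y.obj) (i + 1)) := by
  have h := (h𝔄.ext_bijective (FGModuleCat.of (Λ ⧸ 𝔄) (Λ ⧸ 𝔄)) Y (i + 1)).2
  have hp : Projective (ModuleCat.of (Λ ⧸ 𝔄) (Λ ⧸ 𝔄)) :=
    (IsProjective.iff_projective (R := Λ ⧸ 𝔄) (Λ ⧸ 𝔄)).1 inferInstance
  have h0 : Subsingleton (Ext (ModuleCat.of (Λ ⧸ 𝔄) (Λ ⧸ 𝔄)) Y.obj (i + 1)) :=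
    subsingleton_of_forall_eq 0 fun x => x.eq_zero_of_projective
  exact h.subsingleton

variable {𝔄} in
/-- A `Λ`-module annihilated by `𝔄` is the restriction of a `Λ/𝔄`-module. -/
theorem exists_restrictScalars_iso (Y : Type u) [AddCommGroup Y] [Module Λ Y] [Module.Finite Λ Y]
    (hY : ∀ a ∈ 𝔄, ∀ y : Y, a • y = 0) :
    ∃ Z : FGModuleCat.{u} (Λ ⧸ 𝔄), Nonempty
      ((ModuleCat.restrictScalars.{u} (Ideal.Quotient.mk 𝔄)).obj Z.obj ≅ ModuleCat.of Λ Y) := by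
  have ht : Module.IsTorsionBySet Λ Y (𝔄 : Set Λ) := fun y a => hY a a.2 y
  let _ := ht.module
  have : Module.Finite (Λ ⧸ 𝔄) Y := by
    obtain ⟨s, hs⟩ := (Module.Finite.fg_top : (⊤ : Submodule Λ Y).FG)
    refine ⟨⟨s, eq_top_iff.2 fun y _ => ?_⟩⟩
    have hy : y ∈ Submodule.span Λ (s : Set Y) := hs ▸ Submodule.mem_top
    induction hy using Submodule.span_induction with
    | mem x hx => exact Submodule.subset_span hx
    | zero => exact zero_mem _
    | add x y _ _ h1 h2 => exact add_mem (h1 trivial) (h2 trivial)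
    | smul a x _ h1 => exact Submodule.smul_mem _ (Ideal.Quotient.mk 𝔄 a) (h1 trivial)
  let W : ModuleCat.{u} Λ := (ModuleCat.restrictScalars.{u} (Ideal.Quotient.mk 𝔄)).obj
    (ModuleCat.of (Λ ⧸ 𝔄) Y)
  let e : W ≃ₗ[Λ] ModuleCat.of Λ Y :=
    { toFun := fun y => y
      invFun := fun y => y
      left_inv := fun _ => rfl
      right_inv := fun _ => rfl
      map_add' := fun _ _ => rfl
      map_smul' := fun _ _ => rfl }
  exact ⟨FGModuleCat.of (Λ ⧸ 𝔄) Y, ⟨e.toModuleIso⟩⟩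

theorem IsStrongIdempotentIdeal.subsingleton_ext {𝔄 : Ideal Λ} [𝔄.IsTwoSided]
    (h𝔄 : IsStrongIdempotentIdeal 𝔄) (Y : Type u) [AddCommGroup Y] [Module Λ Y]
    [Module.Finite Λ Y] (hY : ∀ a ∈ 𝔄, ∀ y : Y, a • y = 0) (i : ℕ) :
    Subsingleton (Ext (ModuleCat.of Λ (Λ ⧸ 𝔄)) (ModuleCat.of Λ Y) (i + 1)) := by
  obtain ⟨Z, ⟨e⟩⟩ := exists_restrictScalars_iso Y hY
  have := h𝔄.subsingleton_ext_restrictScalars Z i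
  refine subsingleton_of_forall_eq 0 fun x => ?_
  rw [← x.comp_mk₀_id, ← e.inv_hom_id, ← Ext.mk₀_comp_mk₀, ← Ext.comp_assoc_of_second_deg_zero,
    show x.comp (Ext.mk₀ e.inv) (add_zero _) = 0 from Subsingleton.elim _ _, Ext.zero_comp]

variable {𝔄} in
theorem hasInjectiveDimensionLE_of_annihilated {d l : ℕ}
    (hd : HasProjectiveDimensionLE (rightQuotient 𝔄) d) (hl : gldim (Λ ⧸ 𝔄) ≤ l)
    (Y : Type u) [AddCommGroup Y] [Module Λ Y] [Module.Finite Λ Y]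
    (hY : ∀ a ∈ 𝔄, ∀ y : Y, a • y = 0) :
    HasInjectiveDimensionLE (ModuleCat.of Λ Y) (l + d) := by
  obtain ⟨Z, ⟨e⟩⟩ := exists_restrictScalars_iso Y hY
  have := hasInjectiveDimensionLE_restrictScalars 𝔄 hd hl Z.obj
  exact hasInjectiveDimensionLT_of_iso e _

end TwoSidedIdeal

/-! ### The functors F = Hom_Λ(P, -) and G = Hom_Γ(Hom_Λ(P, Λ), -). -/

section HomModule

variable {Λ P : Type u} [Ring Λ] [AddCommGroup P] [Module Λ P]

/-- The opposite of the endomorphism ring of `P`. -/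
abbrev EndOp (Λ P : Type u) [Ring Λ] [AddCommGroup P] [Module Λ P] : Type u :=
  (Module.End Λ P)ᵐᵒᵖ

/-- `Hom_Λ(P, M)` as a left module over `End_Λ(P)ᵒᵖ`. -/
def HomModule (P M : Type u) [AddCommGroup P] [Module Λ P] [AddCommGroup M] [Module Λ M] :
    Type u :=
  P →ₗ[Λ] M

namespace HomModule

variable {L M N : Type u} [AddCommGroup L] [Module Λ L] [AddCommGroup M] [Module Λ M]
  [AddCommGroup N] [Module Λ N]

instance : AddCommGroup (HomModule (Λ := Λ) P M) := inferInstanceAs (AddCommGroup (P →ₗ[Λ] M))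

instance : FunLike (HomModule (Λ := Λ) P M) P M := inferInstanceAs (FunLike (P →ₗ[Λ] M) P M)

instance : LinearMapClass (HomModule (Λ := Λ) P M) Λ P M :=
  inferInstanceAs (LinearMapClass (P →ₗ[Λ] M) Λ P M)

@[ext]
theorem ext {f g : HomModule (Λ := Λ) P M} (h : ∀ p, f p = g p) : f = g := DFunLike.ext _ _ h

instance : Module (EndOp Λ P) (HomModule (Λ := Λ) P M) where
  smul γ f := LinearMap.comp f γ.unop
  one_smul _ := rfl
  mul_smul _ _ _ := rfl
  smul_zero _ := rfl
  smul_add _ _ _ := rfl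
  add_smul γ δ f := ext fun p => map_add f (γ.unop p) (δ.unop p)
  zero_smul f := ext fun _ => map_zero f

@[simp]
theorem smul_apply (γ : EndOp Λ P) (f : HomModule (Λ := Λ) P M) (p : P) :
    (γ • f) p = f (γ.unop p) := rfl

/-- Postcomposition with a linear map. -/
def map (P : Type u) [AddCommGroup P] [Module Λ P] (g : M →ₗ[Λ] N) :
    HomModule (Λ := Λ) P M →ₗ[EndOp Λ P] HomModule (Λ := Λ) P N where
  toFun f := LinearMap.comp g f
  map_add' f f' := ext fun p => map_add g (f p) (f' p)
  map_smul' _ _ := rfl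

theorem map_injective {g : M →ₗ[Λ] N} (hg : Function.Injective g) :
    Function.Injective (map P g) := fun _ _ h => ext fun p => hg (DFunLike.congr_fun h p)

theorem map_surjective [Module.Projective Λ P] {g : M →ₗ[Λ] N} (hg : Function.Surjective g) :
    Function.Surjective (map P g) := fun h => Module.projective_lifting_property g h hg

theorem map_exact {f : L →ₗ[Λ] M} {g : M →ₗ[Λ] N} (hf : Function.Injective f)
    (hfg : Function.Exact f g) : Function.Exact (map P f) (map P g) := by
  intro h
  constructor
  · intro h0
    have hr : ∀ p, (h : P →ₗ[Λ] M) p ∈ LinearMap.range f := fun p =>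
      (hfg (h p)).1 (DFunLike.congr_fun h0 p)
    let e := LinearEquiv.ofInjective f hf
    exact ⟨e.symm.toLinearMap ∘ₗ LinearMap.codRestrict (LinearMap.range f) h hr, ext fun p =>
      congrArg Subtype.val (e.apply_symm_apply ⟨h p, hr p⟩)⟩
  · rintro ⟨k, rfl⟩
    exact ext fun p => (hfg _).2 ⟨k p, rfl⟩

/-- `Hom_Λ(P, -)` on isomorphisms. -/
def congr (P : Type u) [AddCommGroup P] [Module Λ P] (e : M ≃ₗ[Λ] N) :
    HomModule (Λ := Λ) P M ≃ₗ[EndOp Λ P] HomModule (Λ := Λ) P N :=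
  { map P e.toLinearMap with
    invFun := map P e.symm.toLinearMap
    left_inv := fun f => ext fun p => e.symm_apply_apply (f p)
    right_inv := fun f => ext fun p => e.apply_symm_apply (f p) }

/-- `Hom_Λ(P, -)` commutes with products. -/
def prodEquiv (P M N : Type u) [AddCommGroup P] [Module Λ P] [AddCommGroup M] [Module Λ M]
    [AddCommGroup N] [Module Λ N] :
    HomModule (Λ := Λ) P (M × N) ≃ₗ[EndOp Λ P]
      HomModule (Λ := Λ) P M × HomModule (Λ := Λ) P N :=
  { (map P (LinearMap.fst Λ M N)).prod (map P (LinearMap.snd Λ M N)) with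
    invFun := fun x => LinearMap.prod x.1 x.2
    left_inv := fun _ => rfl
    right_inv := fun _ => rfl }

/-- Evaluation of homomorphisms `P → Λ` at a fixed element of a module. -/
def evalAt (P : Type u) [AddCommGroup P] [Module Λ P] (x : M) :
    HomModule (Λ := Λ) P Λ →ₗ[EndOp Λ P] HomModule (Λ := Λ) P M :=
  map P (LinearMap.toSpanSingleton Λ M x)

@[simp]
theorem evalAt_apply (x : M) (f : HomModule (Λ := Λ) P Λ) (p : P) : evalAt P x f p = f p • x := rfl

end HomModule

theorem exists_dual_basis (Λ P : Type u) [Ring Λ] [AddCommGroup P] [Module Λ P] [Module.Finite Λ P]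
    [Module.Projective Λ P] :
    ∃ (n : ℕ) (f : Fin n → HomModule (Λ := Λ) P Λ) (b : Fin n → P), ∀ p, ∑ i, f i p • b i = p := by
  obtain ⟨n, φ, ψ, -, -, h⟩ := Module.Finite.exists_comp_eq_id_of_projective Λ P
  refine ⟨n, fun i => LinearMap.comp (LinearMap.proj i) ψ, fun i => φ (Pi.single i 1), fun p => ?_⟩
  have h1 : φ (ψ p) = p := LinearMap.congr_fun h p
  conv_rhs => rw [← h1, pi_eq_sum_univ' (ψ p), map_sum]
  refine Finset.sum_congr rfl fun i _ => ?_
  rw [map_smul]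
  rfl

/-- `Hom_Γ(Hom_Λ(P, Λ), U)` as a left `Λ`-module, where `Γ = End_Λ(P)ᵒᵖ`. -/
def CoinducedModule (P U : Type u) [AddCommGroup P] [Module Λ P] [AddCommGroup U]
    [Module (EndOp Λ P) U] : Type u :=
  HomModule (Λ := Λ) P Λ →ₗ[EndOp Λ P] U

namespace CoinducedModule

variable {U V : Type u} [AddCommGroup U] [Module (EndOp Λ P) U] [AddCommGroup V]
  [Module (EndOp Λ P) V] {M N : Type u} [AddCommGroup M] [Module Λ M] [AddCommGroup N] [Module Λ N]

instance : AddCommGroup (CoinducedModule (Λ := Λ) P U) :=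
  inferInstanceAs (AddCommGroup (HomModule (Λ := Λ) P Λ →ₗ[EndOp Λ P] U))

instance : FunLike (CoinducedModule (Λ := Λ) P U) (HomModule (Λ := Λ) P Λ) U :=
  inferInstanceAs (FunLike (HomModule (Λ := Λ) P Λ →ₗ[EndOp Λ P] U) _ _)

instance : LinearMapClass (CoinducedModule (Λ := Λ) P U) (EndOp Λ P) (HomModule (Λ := Λ) P Λ) U :=
  inferInstanceAs (LinearMapClass (HomModule (Λ := Λ) P Λ →ₗ[EndOp Λ P] U) _ _ _)

@[ext]
theorem ext {θ η : CoinducedModule (Λ := Λ) P U} (h : ∀ f, θ f = η f) : θ = η := DFunLike.ext _ _ h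

instance : Module Λ (CoinducedModule (Λ := Λ) P U) where
  smul a θ := LinearMap.comp θ (HomModule.evalAt P a)
  one_smul θ := ext fun f => congrArg θ (HomModule.ext fun p => mul_one (f p))
  mul_smul a b θ := ext fun f => congrArg θ (HomModule.ext fun p => (mul_assoc (f p) a b).symm)
  smul_zero _ := rfl
  smul_add _ _ _ := rfl
  add_smul a b θ := ext fun f =>
    (congrArg θ (HomModule.ext fun p => mul_add (f p) a b)).trans (map_add θ _ _)
  zero_smul θ := ext fun f =>
    (congrArg θ (HomModule.ext fun p => mul_zero (f p))).trans (map_zero θ)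

@[simp]
theorem smul_apply (a : Λ) (θ : CoinducedModule (Λ := Λ) P U) (f : HomModule (Λ := Λ) P Λ) :
    (a • θ) f = θ (HomModule.evalAt P a f) := rfl

/-- Postcomposition with a linear map. -/
def map (g : U →ₗ[EndOp Λ P] V) :
    CoinducedModule (Λ := Λ) P U →ₗ[Λ] CoinducedModule (Λ := Λ) P V where
  toFun θ := LinearMap.comp g θ
  map_add' θ η := ext fun f => map_add g (θ f) (η f)
  map_smul' _ _ := rfl

/-- Coinduction on isomorphisms. -/
def congr (e : U ≃ₗ[EndOp Λ P] V) :
    CoinducedModule (Λ := Λ) P U ≃ₗ[Λ] CoinducedModule (Λ := Λ) P V :=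
  { map e.toLinearMap with
    invFun := map e.symm.toLinearMap
    left_inv := fun θ => ext fun f => e.symm_apply_apply (θ f)
    right_inv := fun θ => ext fun f => e.apply_symm_apply (θ f) }

/-- Coinduction commutes with products. -/
def prodEquiv (P U V : Type u) [AddCommGroup P] [Module Λ P] [AddCommGroup U]
    [Module (EndOp Λ P) U] [AddCommGroup V] [Module (EndOp Λ P) V] :
    CoinducedModule (Λ := Λ) P (U × V) ≃ₗ[Λ]
      CoinducedModule (Λ := Λ) P U × CoinducedModule (Λ := Λ) P V :=
  { (map (LinearMap.fst (EndOp Λ P) U V)).prod (map (LinearMap.snd (EndOp Λ P) U V)) with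
    invFun := fun x => LinearMap.prod x.1 x.2
    left_inv := fun _ => rfl
    right_inv := fun _ => rfl }

/-- The unit `M → Hom_Γ(Hom_Λ(P, Λ), Hom_Λ(P, M))`. -/
def unit (P M : Type u) [AddCommGroup P] [Module Λ P] [AddCommGroup M] [Module Λ M] :
    M →ₗ[Λ] CoinducedModule (Λ := Λ) P (HomModule (Λ := Λ) P M) where
  toFun x := HomModule.evalAt P x
  map_add' x y := ext fun f => HomModule.ext fun p => smul_add (f p) x y
  map_smul' a x := ext fun f => HomModule.ext fun p => (mul_smul (f p) a x).symm

/-- The rank one endomorphism `q ↦ f q • p` of `P`. -/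
def rankOne (f : HomModule (Λ := Λ) P Λ) (p : P) : EndOp Λ P :=
  MulOpposite.op (LinearMap.toSpanSingleton Λ P p ∘ₗ (f : P →ₗ[Λ] Λ))

theorem rankOne_smul (f : HomModule (Λ := Λ) P Λ) (p : P) (g : HomModule (Λ := Λ) P M) :
    rankOne f p • g = HomModule.evalAt P (g p) f :=
  HomModule.ext fun q => map_smul g (f q) p

/-- The trace ideal of `P` maps `Hom_Γ(Hom_Λ(P, Λ), Hom_Λ(P, M))` to the image of `M`. -/
theorem smul_eq_unit (θ : CoinducedModule (Λ := Λ) P (HomModule (Λ := Λ) P M))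
    (f : HomModule (Λ := Λ) P Λ) (p : P) : f p • θ = unit P M (θ f p) := by
  ext g : 1
  rw [smul_apply, ← rankOne_smul, map_smul, rankOne_smul]
  rfl

/-- `U → Hom_Λ(P, Hom_Γ(Hom_Λ(P, Λ), U))`, the inverse of the counit. -/
def toHom (P U : Type u) [AddCommGroup P] [Module Λ P] [AddCommGroup U] [Module (EndOp Λ P) U] :
    U →ₗ[EndOp Λ P] HomModule (Λ := Λ) P (CoinducedModule (Λ := Λ) P U) where
  toFun u :=
    ({ toFun := fun p =>
        ({ toFun := fun f => rankOne f p • u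
           map_add' := fun f g => by
            rw [← add_smul]
            congr 1
            exact MulOpposite.unop_injective (LinearMap.ext fun q => add_smul (f q) (g q) p)
           map_smul' := fun γ f => by
            rw [RingHom.id_apply, ← mul_smul]
            rfl } : HomModule (Λ := Λ) P Λ →ₗ[EndOp Λ P] U)
       map_add' := fun p q => ext fun f => by
        change rankOne f (p + q) • u = rankOne f p • u + rankOne f q • u
        rw [← add_smul]
        congr 1
        exact MulOpposite.unop_injective (LinearMap.ext fun r => smul_add (f r) p q)
       map_smul' := fun a p => ext fun f => by
        change rankOne f (a • p) • u = rankOne (HomModule.evalAt P a f) p • u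
        congr 1
        exact MulOpposite.unop_injective (LinearMap.ext fun r => (mul_smul (f r) a p).symm) } :
      P →ₗ[Λ] CoinducedModule (Λ := Λ) P U)
  map_add' u v := HomModule.ext fun p => ext fun f => smul_add _ u v
  map_smul' γ u := HomModule.ext fun p => ext fun f => by
    change rankOne f p • γ • u = rankOne f (γ.unop p) • u
    rw [← mul_smul]
    congr 1
    exact MulOpposite.unop_injective (LinearMap.ext fun r => map_smul γ.unop (f r) p)

theorem toHom_apply (u : U) (p : P) (f : HomModule (Λ := Λ) P Λ) :
    toHom P U u p f = rankOne f p • u := rfl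

section Projective

variable [Module.Finite Λ P] [Module.Projective Λ P]

/-- With a dual basis (eᵢ, bᵢ), f = ∑ eᵢ(·) f(bᵢ), hence θ(f) = ∑ (f(bᵢ) • θ)(eᵢ). -/
theorem eq_zero_of_forall_smul_eq_zero (θ : CoinducedModule (Λ := Λ) P U)
    (h : ∀ (f : HomModule (Λ := Λ) P Λ) (p : P), f p • θ = 0) : θ = 0 := by
  obtain ⟨n, e, b, hb⟩ := exists_dual_basis Λ P
  ext f
  have hf : f = ∑ i, HomModule.evalAt P (f (b i)) (e i) := by
    ext p
    conv_lhs => rw [← hb p, map_sum]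
    have := map_sum ({ toFun := fun g => g p, map_zero' := rfl, map_add' := fun _ _ => rfl } :
      HomModule (Λ := Λ) P Λ →+ Λ) (fun i => HomModule.evalAt P (f (b i)) (e i)) Finset.univ
    refine Eq.trans (Finset.sum_congr rfl fun i _ => ?_) this.symm
    exact map_smul f (e i p) (b i)
  rw [hf, map_sum]
  exact Finset.sum_eq_zero fun i _ => DFunLike.congr_fun (h f (b i)) (e i)

/-- A dual basis writes the identity of P as ∑ `rankOne (e i) (b i)`. This gives injectivity and
dictates the preimage ∑ h(bᵢ)(eᵢ) of h. -/
theorem toHom_bijective : Function.Bijective (toHom (Λ := Λ) P U) := by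
  obtain ⟨n, e, b, hb⟩ := exists_dual_basis Λ P
  have h1 : ∑ i, rankOne (e i) (b i) = 1 := by
    refine MulOpposite.unop_injective (LinearMap.ext fun p => ?_)
    rw [Finset.unop_sum, LinearMap.sum_apply]
    exact hb p
  constructor
  · rw [← LinearMap.ker_eq_bot, Submodule.eq_bot_iff]
    intro u hu
    rw [← one_smul (EndOp Λ P) u, ← h1, Finset.sum_smul]
    exact Finset.sum_eq_zero fun i _ =>
      DFunLike.congr_fun (DFunLike.congr_fun (LinearMap.mem_ker.1 hu) (b i)) (e i)
  · intro h
    refine ⟨∑ i, h (b i) (e i), HomModule.ext fun p => ext fun f => ?_⟩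
    rw [toHom_apply, Finset.smul_sum]
    conv_rhs => rw [← hb p, map_sum]
    have := map_sum ({ toFun := fun θ => θ f, map_zero' := rfl, map_add' := fun _ _ => rfl } :
      CoinducedModule (Λ := Λ) P U →+ U) (fun i => h (e i p • b i)) Finset.univ
    refine Eq.trans (Finset.sum_congr rfl fun i _ => ?_) this.symm
    change rankOne f p • h (b i) (e i) = h (e i p • b i) f
    rw [map_smul, ← map_smul, rankOne_smul]
    rfl

/-- The counit of the adjunction between `Hom_Λ(P, -)` and coinduction is an isomorphism. -/
noncomputable def homEquiv (P U : Type u) [AddCommGroup P] [Module Λ P] [AddCommGroup U]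
    [Module (EndOp Λ P) U] [Module.Finite Λ P] [Module.Projective Λ P] :
    HomModule (Λ := Λ) P (CoinducedModule (Λ := Λ) P U) ≃ₗ[EndOp Λ P] U :=
  (LinearEquiv.ofBijective (toHom (Λ := Λ) P U) toHom_bijective).symm

/-- G is right adjoint to F, and F preserves monomorphisms. -/
theorem injective [Module.Injective (EndOp Λ P) U] :
    Module.Injective Λ (CoinducedModule (Λ := Λ) P U) where
  out X Y _ _ _ _ i hi φ := by
    obtain ⟨ψ, hψ⟩ := Module.Injective.out (Q := U) (HomModule.map P i) (HomModule.map_injective hi)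
      ((homEquiv P U).toLinearMap ∘ₗ HomModule.map P φ)
    -- The witness is the adjoint transpose of ψ, where ψ extends the transpose of φ along F(i).
    refine ⟨map ψ ∘ₗ unit P Y, fun x => ext fun f => ?_⟩
    have h1 : HomModule.evalAt P (i x) f = HomModule.map P i (HomModule.evalAt P x f) :=
      HomModule.ext fun p => (map_smul i (f p) x).symm
    have h2 : HomModule.map P φ (HomModule.evalAt P x f) = toHom P U (φ x f) :=
      HomModule.ext fun p => ext fun g => by
        rw [toHom_apply, ← map_smul, rankOne_smul, ← smul_apply, ← map_smul]
        rfl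
    change ψ (HomModule.evalAt P (i x) f) = φ x f
    rw [h1, hψ, LinearMap.comp_apply, h2]
    exact (homEquiv P U).apply_symm_apply _

end Projective

end CoinducedModule

end HomModule

/-! ### Γ is an artin algebra, and F and G preserve finite generation. -/

section Finiteness

theorem Module.finite_linearMap_of_finite (R : Type v) [CommRing R] [IsNoetherianRing R]
    (S A B : Type u) [Ring S] [Algebra R S] [AddCommGroup A] [Module S A] [AddCommGroup B]
    [Module S B] [Module R B] [IsScalarTower R S B] [Module.Finite S A] [Module.Finite R B] :
    Module.Finite R (A →ₗ[S] B) := by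
  obtain ⟨s, hs⟩ := (Module.Finite.fg_top : (⊤ : Submodule S A).FG)
  let ev : (A →ₗ[S] B) →ₗ[R] (s → B) :=
    { toFun := fun f x => f x
      map_add' := fun _ _ => rfl
      map_smul' := fun _ _ => rfl }
  exact Module.Finite.of_injective ev fun f g h =>
    LinearMap.ext_on hs fun x hx => congrFun h ⟨x, hx⟩

variable (R : Type v) [CommRing R] [IsArtinianRing R] {Λ : Type u} [Ring Λ] [Algebra R Λ]
  [Module.Finite R Λ] (P : Type u) [AddCommGroup P] [Module Λ P] [Module R P] [IsScalarTower R Λ P]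
  [Module.Finite Λ P]

theorem EndOp.finite : Module.Finite R (EndOp Λ P) := by
  have : Module.Finite R P := Module.Finite.trans Λ P
  have : Module.Finite R (Module.End Λ P) := Module.finite_linearMap_of_finite R Λ P P
  exact Module.Finite.equiv (MulOpposite.opLinearEquiv R)

include R

theorem HomModule.finite (M : Type u) [AddCommGroup M] [Module Λ M] [Module.Finite Λ M] :
    Module.Finite (EndOp Λ P) (HomModule (Λ := Λ) P M) := by
  let _ : Module R M := Module.compHom M (algebraMap R Λ)
  have : IsScalarTower R Λ M := ⟨fun r l x => by rw [Algebra.smul_def, mul_smul]; rfl⟩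
  have : Module.Finite R M := Module.Finite.trans Λ M
  let _ : Module R (HomModule (Λ := Λ) P M) := inferInstanceAs (Module R (P →ₗ[Λ] M))
  have : Module.Finite R (HomModule (Λ := Λ) P M) := Module.finite_linearMap_of_finite R Λ P M
  have : IsScalarTower R (EndOp Λ P) (HomModule (Λ := Λ) P M) :=
    ⟨fun r γ f => HomModule.ext fun p => LinearMap.map_smul_of_tower (f : P →ₗ[Λ] M) r (γ.unop p)⟩
  exact Module.Finite.of_restrictScalars_finite R _ _

theorem CoinducedModule.finite (U : Type u) [AddCommGroup U] [Module (EndOp Λ P) U]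
    [Module.Finite (EndOp Λ P) U] : Module.Finite Λ (CoinducedModule (Λ := Λ) P U) := by
  have := EndOp.finite R (Λ := Λ) P
  have := HomModule.finite R P (Λ := Λ) Λ
  let _ : Module R U := Module.compHom U (algebraMap R (EndOp Λ P))
  have : IsScalarTower R (EndOp Λ P) U := ⟨fun r l x => by rw [Algebra.smul_def, mul_smul]; rfl⟩
  have : Module.Finite R U := Module.Finite.trans (EndOp Λ P) U
  let _ : Module R (CoinducedModule (Λ := Λ) P U) :=
    inferInstanceAs (Module R (HomModule (Λ := Λ) P Λ →ₗ[EndOp Λ P] U))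
  have : Module.Finite R (CoinducedModule (Λ := Λ) P U) :=
    Module.finite_linearMap_of_finite R (EndOp Λ P) (HomModule (Λ := Λ) P Λ) U
  have : IsScalarTower R Λ (CoinducedModule (Λ := Λ) P U) :=
    ⟨fun r a θ => CoinducedModule.ext fun f => by
      have h : HomModule.evalAt P (r • a) f =
          algebraMap R (EndOp Λ P) r • HomModule.evalAt P a f := HomModule.ext fun p => by
        have h1 : (algebraMap R (EndOp Λ P) r).unop p = r • p := rfl
        rw [HomModule.smul_apply, h1, HomModule.evalAt_apply, HomModule.evalAt_apply,
          ← algebraMap_smul Λ r p, map_smul, smul_eq_mul, smul_eq_mul, smul_eq_mul, Algebra.smul_def,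
          ← mul_assoc, (Algebra.commutes r (f p)).symm]
      change θ (HomModule.evalAt P (r • a) f) =
        algebraMap R (EndOp Λ P) r • θ (HomModule.evalAt P a f)
      rw [h, map_smul]⟩
  exact Module.Finite.of_restrictScalars_finite R _ _

end Finiteness

/-! ### Torsion-free and perpendicular modules for the trace ideal. -/

section Perpendicular

open Abelian

variable (Λ : Type u) [Ring Λ] (P : Type u) [AddCommGroup P] [Module Λ P]

/-- `N` has no nonzero element annihilated by the trace ideal of `P`. -/
def IsTraceTorsionFree (N : Type u) [AddCommGroup N] [Module Λ N] : Prop :=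
  ∀ x : N, (∀ (f : HomModule (Λ := Λ) P Λ) (p : P), f p • x = 0) → x = 0

/-- The modules `N` with `Ext^i(Λ/𝔄, N) = 0` for all `i ≥ 0`, where `𝔄` is the trace of `P`. -/
structure IsTracePerpendicular (N : Type u) [AddCommGroup N] [Module Λ N] : Prop where
  torsionFree : IsTraceTorsionFree Λ P N
  subsingleton_ext : ∀ i, Subsingleton
    (Ext (ModuleCat.of Λ (Λ ⧸ traceInRing Λ P)) (ModuleCat.of Λ N) (i + 1))

/-- The elements annihilated by the trace ideal of `P`. -/
def traceTorsion (N : Type u) [AddCommGroup N] [Module Λ N] : Submodule Λ N where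
  carrier := {x | ∀ (f : HomModule (Λ := Λ) P Λ) (p : P), f p • x = 0}
  add_mem' hx hy f p := by rw [smul_add, hx f p, hy f p, add_zero]
  zero_mem' f p := smul_zero _
  smul_mem' a x hx f p := by rw [← mul_smul]; exact hx (HomModule.evalAt P a f) p

variable {Λ P} {N : Type u} [AddCommGroup N] [Module Λ N]

theorem smul_eq_zero_of_mem_traceInRing {x : N}
    (hx : ∀ (f : HomModule (Λ := Λ) P Λ) (p : P), f p • x = 0) {a : Λ}
    (ha : a ∈ traceInRing Λ P) : a • x = 0 := by
  have h : traceInRing Λ P ≤ LinearMap.ker (LinearMap.toSpanSingleton Λ N x) :=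
    iSup_le fun f => by
      rintro _ ⟨p, rfl⟩
      exact hx f p
  exact h ha

/-- An element of C killed by 𝔄 is a map Λ/𝔄 → C. It lifts to B because Ext¹(Λ/𝔄, A) = 0, and the
lift is zero because B is torsion-free. -/
theorem IsTraceTorsionFree.quotient {A B C : Type u} [AddCommGroup A] [Module Λ A] [AddCommGroup B]
    [Module Λ B] [AddCommGroup C] [Module Λ C] {f : A →ₗ[Λ] B} {g : B →ₗ[Λ] C}
    (hf : Function.Injective f) (hfg : Function.Exact f g) (hg : Function.Surjective g)
    (hB : IsTraceTorsionFree Λ P B)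
    (hA : Subsingleton (Ext (ModuleCat.of Λ (Λ ⧸ traceInRing Λ P)) (ModuleCat.of Λ A) 1)) :
    IsTraceTorsionFree Λ P C := by
  intro x hx
  let h : (Λ ⧸ traceInRing Λ P) →ₗ[Λ] C := Submodule.liftQ _ (LinearMap.toSpanSingleton Λ C x)
    fun a ha => smul_eq_zero_of_mem_traceInRing hx ha
  obtain ⟨k, hk⟩ := ModuleCat.exists_lift_of_subsingleton_ext hf hfg hg hA h
  have h1 : k (Submodule.Quotient.mk 1) = 0 := hB _ fun e p => by
    rw [← map_smul, ← Submodule.Quotient.mk_smul, smul_eq_mul, mul_one,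
      (Submodule.Quotient.mk_eq_zero _).2, map_zero]
    exact Submodule.mem_iSup_of_mem (p := fun f : P →ₗ[Λ] Λ => LinearMap.range f) e ⟨p, rfl⟩
  have h2 : h (Submodule.Quotient.mk 1) = x := one_smul Λ x
  rw [← h2, ← hk, LinearMap.comp_apply, h1, map_zero]

theorem isTraceTorsionFree_coinducedModule [Module.Finite Λ P] [Module.Projective Λ P] (U : Type u)
    [AddCommGroup U] [Module (EndOp Λ P) U] :
    IsTraceTorsionFree Λ P (CoinducedModule (Λ := Λ) P U) :=
  CoinducedModule.eq_zero_of_forall_smul_eq_zero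

/-- The trace ideal is idempotent: f(p) = ∑ eᵢ(p) f(bᵢ) for a dual basis. So an element killed
modulo torsion is itself torsion. -/
theorem isTraceTorsionFree_quotient_traceTorsion [Module.Finite Λ P] [Module.Projective Λ P] :
    IsTraceTorsionFree Λ P (N ⧸ traceTorsion Λ P N) := by
  obtain ⟨n, e, b, hb⟩ := exists_dual_basis Λ P
  intro x hx
  obtain ⟨x, rfl⟩ := Submodule.mkQ_surjective _ x
  refine (Submodule.Quotient.mk_eq_zero _).2 fun f p => ?_
  rw [← hb p, map_sum, Finset.sum_smul]
  refine Finset.sum_eq_zero fun i _ => ?_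
  rw [map_smul, smul_assoc]
  exact (Submodule.Quotient.mk_eq_zero _).1 (hx f (b i)) (e i) p

/-- Since P = 𝔄P, a map from P to a module killed by 𝔄 vanishes. -/
theorem subsingleton_homModule_traceTorsion [Module.Finite Λ P] [Module.Projective Λ P] :
    Subsingleton (HomModule (Λ := Λ) P (traceTorsion Λ P N)) := by
  obtain ⟨n, e, b, hb⟩ := exists_dual_basis Λ P
  refine subsingleton_of_forall_eq 0 fun h => HomModule.ext fun p => ?_
  rw [← hb p, map_sum]
  exact Finset.sum_eq_zero fun i _ =>
    (map_smul h _ _).trans (Subtype.ext ((h (b i)).2 (e i) p))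

theorem IsTraceTorsionFree.unit_injective (hN : IsTraceTorsionFree Λ P N) :
    Function.Injective (CoinducedModule.unit (Λ := Λ) P N) := by
  rw [← LinearMap.ker_eq_bot, Submodule.eq_bot_iff]
  exact fun x hx => hN x fun f p => DFunLike.congr_fun (DFunLike.congr_fun hx f) p

variable [Module.Finite Λ P] [Module.Projective Λ P]

/-- The cokernel of the unit is killed by 𝔄 (`CoinducedModule.smul_eq_unit`), yet torsion-free
because GFN is and Ext¹(Λ/𝔄, N) = 0. Hence it is zero. -/
theorem IsTracePerpendicular.unit_bijective (hN : IsTracePerpendicular Λ P N) :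
    Function.Bijective (CoinducedModule.unit (Λ := Λ) P N) := by
  refine ⟨hN.torsionFree.unit_injective, fun θ => ?_⟩
  have h := IsTraceTorsionFree.quotient hN.torsionFree.unit_injective
    (LinearMap.exact_map_mkQ_range _) (Submodule.mkQ_surjective _)
    (isTraceTorsionFree_coinducedModule _) (hN.subsingleton_ext 0)
  refine (Submodule.Quotient.mk_eq_zero _).1 (h (Submodule.Quotient.mk θ) fun f p => ?_)
  rw [← Submodule.Quotient.mk_smul]
  exact (Submodule.Quotient.mk_eq_zero _).2 ⟨_, (CoinducedModule.smul_eq_unit θ f p).symm⟩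

end Perpendicular

/-! ### Transfer of cosyzygies and classes between Λ and Γ. -/

section Transfer

open Abelian

variable (R : Type v) [CommRing R] [IsArtinianRing R] {Λ : Type u} [Ring Λ] [Algebra R Λ]
  [Module.Finite R Λ] (P : Type u) [AddCommGroup P] [Module Λ P] [Module R P] [IsScalarTower R Λ P]
  [Module.Finite Λ P]

/-- `Hom_Λ(P, M)` as a finitely generated module over `End_Λ(P)ᵒᵖ`. -/
def homObj (M : FGModuleCat.{u} Λ) : FGModuleCat.{u} (EndOp Λ P) :=
  have := HomModule.finite R P (Λ := Λ) M
  FGModuleCat.of (EndOp Λ P) (HomModule (Λ := Λ) P M)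

/-- `Hom_Γ(Hom_Λ(P, Λ), U)` as a finitely generated module over `Λ`. -/
def coinducedObj (U : FGModuleCat.{u} (EndOp Λ P)) : FGModuleCat.{u} Λ :=
  have := CoinducedModule.finite R P (Λ := Λ) U
  FGModuleCat.of Λ (CoinducedModule (Λ := Λ) P U)

variable {P} in
-- Compose the unit N → GFN with G applied to an embedding FN → J.
theorem IsTraceTorsionFree.exists_injective_embedding {N : FGModuleCat.{u} Λ}
    (hN : IsTraceTorsionFree Λ P N) :
    ∃ (J : FGModuleCat.{u} (EndOp Λ P)) (κ : N →ₗ[Λ] coinducedObj R P J),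
      Module.Injective (EndOp Λ P) J ∧ Function.Injective κ := by
  have := EndOp.finite R (Λ := Λ) P
  obtain ⟨J, j, hJ, hj⟩ := exists_fg_injective R (Λ := EndOp Λ P) (homObj R P N)
  have hj' : Function.Injective
      (CoinducedModule.map (j : HomModule (Λ := Λ) P N →ₗ[EndOp Λ P] J)) :=
    fun θ η h => CoinducedModule.ext fun f => hj (DFunLike.congr_fun h f)
  exact ⟨J, CoinducedModule.map j ∘ₗ CoinducedModule.unit P N, hJ, hj'.comp hN.unit_injective⟩

variable [Module.Projective Λ P]

/-- Coinduction induces a homomorphism of Grothendieck groups modulo injectives. -/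
def coinducedHom : InjStableK0 (EndOp Λ P) →+ InjStableK0 Λ :=
  InjStableK0.lift (fun U => injStableClass (coinducedObj R P U))
    (fun A B _ e => injStableClass_add (A := coinducedObj R P A) (B := coinducedObj R P B)
      (CoinducedModule.congr e ≪≫ₗ CoinducedModule.prodEquiv P A B))
    (fun _ _ => injStableClass_injective _ (CoinducedModule.injective (P := P)))

variable {P}

theorem coinducedHom_injStableClass_homObj (N : FGModuleCat.{u} Λ)
    (hN : IsTracePerpendicular Λ P N) :
    coinducedHom R P (injStableClass (homObj R P N)) = injStableClass N :=
  (InjStableK0.lift_injStableClass _ _ _ _).trans (injStableClass_congr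
    (A := coinducedObj R P (homObj R P N)) (LinearEquiv.ofBijective _ hN.unit_bijective).symm)

/-- Such an N is a retract of some GJ with J injective, so FN is a retract of FGJ ≅ J. -/
theorem injStableClass_homObj_eq_zero {N : FGModuleCat.{u} Λ} (hN : IsTraceTorsionFree Λ P N)
    (hinj : Module.Injective Λ N) : injStableClass (homObj R P N) = 0 := by
  obtain ⟨J, κ, hJ, hκ⟩ := hN.exists_injective_embedding R
  obtain ⟨r, hr⟩ := Module.Injective.out (Q := N) κ hκ LinearMap.id
  let e := CoinducedModule.homEquiv (Λ := Λ) P J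
  exact injStableClass_injective _ (injective_of_retract (A := HomModule (Λ := Λ) P N) (B := J)
    (e.toLinearMap ∘ₗ HomModule.map P κ) (HomModule.map P r ∘ₗ e.symm.toLinearMap) fun a =>
      (congrArg (HomModule.map P r) (e.symm_apply_apply (HomModule.map P κ a))).trans
        (HomModule.ext fun p => hr (a p)))

/-- The sequence 0 → N → GJ → N₁ → 0 serves both rings at once: GJ is injective over Λ, F is exact,
and FGJ ≅ J is injective over Γ. Dimension shifting keeps N₁ perpendicular. -/
theorem IsTracePerpendicular.exists_cosyzygy {N : FGModuleCat.{u} Λ}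
    (hN : IsTracePerpendicular Λ P N) :
    ∃ N₁ : FGModuleCat.{u} Λ, IsTracePerpendicular Λ P N₁ ∧
      (∀ t, (cosyzygyHom Λ ^ (t + 1)) (injStableClass N) =
        (cosyzygyHom Λ ^ t) (injStableClass N₁)) ∧
      (∀ t, (cosyzygyHom (EndOp Λ P) ^ (t + 1)) (injStableClass (homObj R P N)) =
        (cosyzygyHom (EndOp Λ P) ^ t) (injStableClass (homObj R P N₁))) ∧
      ∀ k, HasInjectiveDimensionLE N.obj (k + 1) → HasInjectiveDimensionLE N₁.obj k := by
  have := EndOp.finite R (Λ := Λ) P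
  obtain ⟨J, κ, hJ, hκ⟩ := hN.torsionFree.exists_injective_embedding R
  have hG : Module.Injective Λ (coinducedObj R P J) := CoinducedModule.injective (P := P)
  have hex := LinearMap.exact_map_mkQ_range κ
  have hs := Submodule.mkQ_surjective (LinearMap.range κ)
  refine ⟨FGModuleCat.of Λ (coinducedObj R P J ⧸ LinearMap.range κ), ⟨?_, fun i => ?_⟩,
    fun t => ?_, fun t => ?_, fun k hk => ?_⟩
  · exact IsTraceTorsionFree.quotient hκ hex hs (isTraceTorsionFree_coinducedModule _)
      (hN.subsingleton_ext 0)
  · exact ModuleCat.subsingleton_ext_right_of_exact hκ hex hs _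
      (ModuleCat.subsingleton_ext_of_injective _ _ _) (hN.subsingleton_ext (i + 1))
  · exact (cosyzygyHom_spec R Λ).pow_succ_apply κ _ hG hκ hex hs t
  · let e := CoinducedModule.homEquiv (Λ := Λ) P J
    have hinj : Module.Injective (EndOp Λ P) (homObj R P (coinducedObj R P J)) :=
      injective_of_retract (B := J) e.toLinearMap e.symm.toLinearMap e.symm_apply_apply
    exact (cosyzygyHom_spec R (EndOp Λ P)).pow_succ_apply (M := homObj R P N)
      (I := homObj R P (coinducedObj R P J))
      (C := homObj R P (FGModuleCat.of Λ (coinducedObj R P J ⧸ LinearMap.range κ)))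
      (HomModule.map P κ) (HomModule.map P (LinearMap.range κ).mkQ) hinj
      (HomModule.map_injective hκ) (HomModule.map_exact hκ hex) (HomModule.map_surjective hs) t
  · exact ModuleCat.hasInjectiveDimensionLE_quotient hκ hex hs hG hk

theorem IsTracePerpendicular.exists_cosyzygy_pow {N : FGModuleCat.{u} Λ}
    (hN : IsTracePerpendicular Λ P N) (t : ℕ) :
    ∃ N₁ : FGModuleCat.{u} Λ, IsTracePerpendicular Λ P N₁ ∧
      (cosyzygyHom Λ ^ t) (injStableClass N) = injStableClass N₁ ∧
      (cosyzygyHom (EndOp Λ P) ^ t) (injStableClass (homObj R P N)) =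
        injStableClass (homObj R P N₁) ∧
      ∀ k, HasInjectiveDimensionLE N.obj (k + t) → HasInjectiveDimensionLE N₁.obj k := by
  induction t generalizing N with
  | zero => exact ⟨N, hN, rfl, rfl, fun k hk => hk⟩
  | succ t ih =>
    obtain ⟨N₁, h₁, h₂, h₃, h₄⟩ := hN.exists_cosyzygy R
    obtain ⟨N₂, i₁, i₂, i₃, i₄⟩ := ih h₁
    exact ⟨N₂, i₁, (h₂ t).trans i₂, (h₃ t).trans i₃, fun k hk => i₄ k (h₄ _ hk)⟩

variable {k : ℕ}
  (hext : ∀ (Y : Type u) [AddCommGroup Y] [Module Λ Y] [Module.Finite Λ Y],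
    (∀ a ∈ traceInRing Λ P, ∀ y : Y, a • y = 0) → ∀ i,
      Subsingleton (Ext (ModuleCat.of Λ (Λ ⧸ traceInRing Λ P)) (ModuleCat.of Λ Y) (i + 1)))
  (hdim : ∀ (Y : Type u) [AddCommGroup Y] [Module Λ Y] [Module.Finite Λ Y],
    (∀ a ∈ traceInRing Λ P, ∀ y : Y, a • y = 0) → HasInjectiveDimensionLE (ModuleCat.of Λ Y) k)

include hext hdim

/-- N₁ is N modulo its torsion S. As S is killed by 𝔄, it has no higher Ext from Λ/𝔄, its injective
dimension is at most k, and FS = 0. -/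
theorem exists_isTracePerpendicular (N : FGModuleCat.{u} Λ)
    (hN : ∀ i, Subsingleton
      (Ext (ModuleCat.of Λ (Λ ⧸ traceInRing Λ P)) N.obj (i + 1))) :
    ∃ N₁ : FGModuleCat.{u} Λ, IsTracePerpendicular Λ P N₁ ∧
      (cosyzygyHom Λ ^ k) (injStableClass N) = (cosyzygyHom Λ ^ k) (injStableClass N₁) ∧
      injStableClass (homObj R P N) = injStableClass (homObj R P N₁) ∧
      (Module.Injective Λ N → HasInjectiveDimensionLE N₁.obj k) := by
  have : IsArtinianRing Λ := IsArtinianRing.of_finite R Λ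
  let S := traceTorsion Λ P N
  have hS : ∀ a ∈ traceInRing Λ P, ∀ y : S, a • y = 0 := fun a ha y =>
    Subtype.ext (smul_eq_zero_of_mem_traceInRing y.2 ha)
  have hi := S.subtype_injective
  have hex := LinearMap.exact_subtype_mkQ S
  have hs := S.mkQ_surjective
  refine ⟨FGModuleCat.of Λ (N ⧸ S), ⟨isTraceTorsionFree_quotient_traceTorsion (Λ := Λ), fun i => ?_⟩,
    ?_, ?_, fun hinj => ?_⟩
  · exact ModuleCat.subsingleton_ext_right_of_exact hi hex hs _ (hN i) (hext S hS (i + 1))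
  · exact cosyzygyHom_pow_eq_of_exact R k (A := FGModuleCat.of Λ S) hi hex hs (hdim S hS)
  · have := subsingleton_homModule_traceTorsion (Λ := Λ) (P := P) (N := N)
    refine injStableClass_congr (A := homObj R P N) (B := homObj R P (FGModuleCat.of Λ (N ⧸ S)))
      (LinearEquiv.ofBijective (HomModule.map P S.mkQ) ⟨?_, HomModule.map_surjective hs⟩)
    rw [← LinearMap.ker_eq_bot, Submodule.eq_bot_iff]
    intro h hh
    obtain ⟨h', rfl⟩ := (HomModule.map_exact hi hex h).1 hh
    rw [Subsingleton.elim h' 0, map_zero]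
  · have := Module.injective_object_of_injective_module Λ N
    exact (ModuleCat.shortExact_of_exact hi hex hs).hasInjectiveDimensionLT_X₃ (k + 1)
      (hasInjectiveDimensionLT_of_ge N.obj 1 _ (by lia))
      (have := hdim S hS; hasInjectiveDimensionLT_of_ge (ModuleCat.of Λ S) (k + 1) _ (by lia))

/-- Modulo torsion, I becomes perpendicular of injective dimension at most k with the same image
under F. Its k-th cosyzygy is then perpendicular and injective, and F sends such a module to an
injective. -/
theorem cosyzygyHom_pow_homObj_eq_zero_of_injective (I : FGModuleCat.{u} Λ)
    (hI : Module.Injective Λ I) :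
    (cosyzygyHom (EndOp Λ P) ^ k) (injStableClass (homObj R P I)) = 0 := by
  obtain ⟨N, hN, -, h2, h3⟩ := exists_isTracePerpendicular R hext hdim I fun i =>
    ModuleCat.subsingleton_ext_of_injective _ I i
  obtain ⟨N₁, hN₁, -, h5, h6⟩ := hN.exists_cosyzygy_pow R k
  rw [h2, h5]
  exact injStableClass_homObj_eq_zero R hN₁.torsionFree
    (ModuleCat.injective_of_hasInjectiveDimensionLE_zero (h6 0 (by rw [zero_add]; exact h3 hI)))

theorem cosyzygyHom_pow_homObj_congr {A B : FGModuleCat.{u} Λ}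
    (h : injStableClass A = injStableClass B) :
    (cosyzygyHom (EndOp Λ P) ^ k) (injStableClass (homObj R P A)) =
      (cosyzygyHom (EndOp Λ P) ^ k) (injStableClass (homObj R P B)) := by
  let ψ : InjStableK0 Λ →+ InjStableK0 (EndOp Λ P) :=
    InjStableK0.lift (fun M => (cosyzygyHom (EndOp Λ P) ^ k) (injStableClass (homObj R P M)))
      (fun A B C e => by
        rw [injStableClass_add (A := homObj R P A) (B := homObj R P B)
          (HomModule.congr P e ≪≫ₗ HomModule.prodEquiv P A B)]
        exact map_add _ _ _)
      (cosyzygyHom_pow_homObj_eq_zero_of_injective R hext hdim)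
  have := congrArg ψ h
  simpa only [ψ, InjStableK0.lift_injStableClass] using this

end Transfer

/-- Both classes lie in ⟨add(A ⊕ B)⟩, so the bound on φ_r(A ⊕ B) lowers the exponent one step at a
time down to t ≥ n. -/
theorem cosyzygyHom_pow_eq_zero_of_phiRDim_le {Γ : Type u} [Ring Γ] {n : ℕ} (hn : phiRDim Γ ≤ n)
    (A B : FGModuleCat.{u} Γ) {t : ℕ} (ht : n ≤ t) (j : ℕ)
    (h : (cosyzygyHom Γ ^ (t + j)) (injStableClass A - injStableClass B) = 0) :
    (cosyzygyHom Γ ^ t) (injStableClass A - injStableClass B) = 0 := by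
  let K : FGModuleCat.{u} Γ := FGModuleCat.of Γ (A × B)
  have hK : phiR K ≤ n := (le_iSup (fun M : FGModuleCat.{u} Γ => phiR M) K).trans hn
  have hx : injStableClass A - injStableClass B ∈ addClosure K :=
    sub_mem (AddSubgroup.subset_closure ⟨A, B, ⟨LinearEquiv.refl Γ (A × B)⟩, rfl⟩)
      (AddSubgroup.subset_closure ⟨B, A, ⟨LinearEquiv.prodComm Γ A B⟩, rfl⟩)
  induction j with
  | zero => exact h
  | succ j ih => exact ih ((phiR_le_iff K n).1 hK (t + j) (by lia) _ hx h)

/-! ### The bound r + max(k, n) and the theorem. -/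

section Bound

open Abelian

variable (R : Type v) [CommRing R] [IsArtinianRing R] {Λ : Type u} [Ring Λ] [Algebra R Λ]
  [Module.Finite R Λ] (P : Type u) [AddCommGroup P] [Module Λ P] [Module R P] [IsScalarTower R Λ P]
  [Module.Finite Λ P] [Module.Projective Λ P]

include R

theorem cosyzygyHom_pow_eq_zero {r k n : ℕ}
    (hr : HasProjectiveDimensionLE (ModuleCat.of Λ (Λ ⧸ traceInRing Λ P)) r)
    (hext : ∀ (Y : Type u) [AddCommGroup Y] [Module Λ Y] [Module.Finite Λ Y],
      (∀ a ∈ traceInRing Λ P, ∀ y : Y, a • y = 0) → ∀ i,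
        Subsingleton (Ext (ModuleCat.of Λ (Λ ⧸ traceInRing Λ P)) (ModuleCat.of Λ Y) (i + 1)))
    (hdim : ∀ (Y : Type u) [AddCommGroup Y] [Module Λ Y] [Module.Finite Λ Y],
      (∀ a ∈ traceInRing Λ P, ∀ y : Y, a • y = 0) → HasInjectiveDimensionLE (ModuleCat.of Λ Y) k)
    (hn : phiRDim (EndOp Λ P) ≤ n) {s : ℕ} (hs : r + max k n ≤ s) (x : InjStableK0 Λ)
    (hx : (cosyzygyHom Λ ^ (s + 1)) x = 0) : (cosyzygyHom Λ ^ s) x = 0 := by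
  -- The r cosyzygies make the modules Ext(Λ/𝔄, -)-acyclic; the remaining t absorb the torsion (t ≥
  -- k) and reach the stable range over Γ (t ≥ n).
  obtain ⟨t, rfl⟩ : ∃ t, s = t + r := ⟨s - r, by lia⟩
  have hk : k ≤ t := by lia
  have hnt : n ≤ t := by lia
  have hperp : ∀ M : FGModuleCat.{u} Λ, ∃ N : FGModuleCat.{u} Λ, IsTracePerpendicular Λ P N ∧
      ∀ j, (cosyzygyHom Λ ^ (t + j + r)) (injStableClass M) =
        (cosyzygyHom Λ ^ (t + j)) (injStableClass N) := by
    intro M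
    obtain ⟨N, h1, h2⟩ := exists_cosyzygy_ext_vanishing R
      (ModuleCat.of Λ (Λ ⧸ traceInRing Λ P)) r M fun i =>
        HasProjectiveDimensionLT.subsingleton _ (r + 1) _ (by lia) _
    obtain ⟨N₁, h3, h4, -⟩ := exists_isTracePerpendicular R hext hdim N h1
    refine ⟨N₁, h3, fun j => ?_⟩
    obtain ⟨c, hc⟩ : ∃ c, t + j = c + k := ⟨t + j - k, by lia⟩
    rw [hc, pow_add _ (c + k) r, AddMonoid.End.coe_mul, Function.comp_apply, h2, pow_add,
      AddMonoid.End.coe_mul, Function.comp_apply, h4]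
    rfl
  obtain ⟨A, B, rfl⟩ := exists_eq_injStableClass_sub x
  obtain ⟨A', hA', hA⟩ := hperp A
  obtain ⟨B', hB', hB⟩ := hperp B
  have hx' : (cosyzygyHom Λ ^ (t + 1)) (injStableClass A') =
      (cosyzygyHom Λ ^ (t + 1)) (injStableClass B') := by
    rw [← hA 1, ← hB 1, show t + 1 + r = t + r + 1 by lia]
    exact sub_eq_zero.1 ((map_sub _ _ _).symm.trans hx)
  refine (map_sub _ _ _).trans (sub_eq_zero.2 ((hA 0).trans (Eq.trans ?_ (hB 0).symm)))
  rw [add_zero]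
  obtain ⟨A₁, -, hA₁, hA₁', -⟩ := hA'.exists_cosyzygy_pow R (t + 1)
  obtain ⟨B₁, -, hB₁, hB₁', -⟩ := hB'.exists_cosyzygy_pow R (t + 1)
  have h1 := cosyzygyHom_pow_homObj_congr R hext hdim (hA₁.symm.trans (hx'.trans hB₁))
  -- The exponent is t + 1, needed to reach A₁ and B₁, plus the k that make F well defined on
  -- classes.
  have h2 : (cosyzygyHom (EndOp Λ P) ^ (t + (k + 1)))
      (injStableClass (homObj R P A') - injStableClass (homObj R P B')) = 0 := by
    refine (map_sub _ _ _).trans (sub_eq_zero.2 ?_)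
    rw [show t + (k + 1) = k + (t + 1) by lia, pow_add, AddMonoid.End.coe_mul, Function.comp_apply,
      Function.comp_apply, hA₁', hB₁', h1]
  have h3 := sub_eq_zero.1 ((map_sub _ _ _).symm.trans
    (cosyzygyHom_pow_eq_zero_of_phiRDim_le hn _ _ hnt (k + 1) h2))
  -- At stage t the cosyzygies are still perpendicular, so G recovers their classes from those over
  -- Γ.
  obtain ⟨A₂, hA₂, hA₂', hA₂'', -⟩ := hA'.exists_cosyzygy_pow R t
  obtain ⟨B₂, hB₂, hB₂', hB₂'', -⟩ := hB'.exists_cosyzygy_pow R t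
  rw [hA₂', hB₂', ← coinducedHom_injStableClass_homObj R A₂ hA₂,
    ← coinducedHom_injStableClass_homObj R B₂ hB₂, ← hA₂'', ← hB₂'', h3]

end Bound

theorem proposition4p16 (R : Type v) [CommRing R] [IsArtinianRing R]
    (Λ : Type u) [Ring Λ] [Algebra R Λ] [Module.Finite R Λ]
    (𝔄 : Ideal Λ) [𝔄.IsTwoSided] (h𝔄 : IsStrongIdempotentIdeal 𝔄)
    (P : Type u) [AddCommGroup P] [Module Λ P] [Module.Finite Λ P] [Module.Projective Λ P]
    (hP : 𝔄 = traceInRing Λ P) :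
    phiRDim Λ ≤ pdim Λ (ModuleCat.of Λ (Λ ⧸ 𝔄)) +
      max (gldim (Λ ⧸ 𝔄) + pdim Λᵐᵒᵖ (rightQuotient 𝔄) + 1)
        (phiRDim (Module.End Λ P)ᵐᵒᵖ) := by
  subst hP
  let _ : Module R P := Module.compHom P (algebraMap R Λ)
  have : IsScalarTower R Λ P := ⟨fun r l x => by rw [Algebra.smul_def, mul_smul]; rfl⟩
  -- If any of the four invariants is infinite, the right-hand side is ⊤.
  obtain ⟨r, hr⟩ | hr := (em (∃ r : ℕ, pdim Λ (ModuleCat.of Λ (Λ ⧸ traceInRing Λ P)) = r)).imp_right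
    fun h => ENat.eq_top_iff_forall_ne.2 fun m hm => h ⟨m, hm.symm⟩
  swap; · rw [hr, top_add]; exact le_top
  obtain ⟨l, hl⟩ | hl := (em (∃ l : ℕ, gldim (Λ ⧸ traceInRing Λ P) = l)).imp_right
    fun h => ENat.eq_top_iff_forall_ne.2 fun m hm => h ⟨m, hm.symm⟩
  swap; · rw [hl, top_add, top_add, max_eq_left le_top, add_top]; exact le_top
  obtain ⟨d, hd⟩ | hd :=
    (em (∃ d : ℕ, pdim Λᵐᵒᵖ (rightQuotient (traceInRing Λ P)) = d)).imp_right
      fun h => ENat.eq_top_iff_forall_ne.2 fun m hm => h ⟨m, hm.symm⟩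
  swap; · rw [hd, add_top, top_add, max_eq_left le_top, add_top]; exact le_top
  obtain ⟨n, hn⟩ | hn := (em (∃ n : ℕ, phiRDim (Module.End Λ P)ᵐᵒᵖ = n)).imp_right
    fun h => ENat.eq_top_iff_forall_ne.2 fun m hm => h ⟨m, hm.symm⟩
  swap; · rw [hn, max_eq_right le_top, add_top]; exact le_top
  rw [hr, hl, hd, hn]
  have hbound : (r : ℕ∞) + max ((l : ℕ∞) + d + 1) n = (r + max (l + d + 1) n : ℕ) := by
    push_cast
    rfl
  rw [hbound]
  refine iSup_le fun M => (phiR_le_iff M _).2 fun s hs x _ hx => ?_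
  -- Here k = l + d, so the summand `+ 1` in the bound is slack.
  exact cosyzygyHom_pow_eq_zero R P (hasProjectiveDimensionLE_of_pdim_le hr.le)
    (fun Y _ _ _ hY i => h𝔄.subsingleton_ext Y hY i)
    (fun Y _ _ _ hY => hasInjectiveDimensionLE_of_annihilated
      (hasProjectiveDimensionLE_of_pdim_le hd.le) hl.le Y hY) hn.le
    (by lia) x hx
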